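/- Let $\mathfrak g,\mathfrak h$ be complex separable Hilbert spaces, each equipped with a complex conjugation $J$ (an antilinear isometric involution), and write $B^{\top}=JB^\dagger J$ for the transpose and $(B,\rho)=\operatorname{Tr}(B\rho^{\top})$ for the trace pairing of a bounded operator $B$ with a trace class operator $\rho$. A density operator $\rho$ on $\mathfrak g$ corresponds to the normal state $\varrho(A)=(A,\rho)$ on $\mathcal B(\mathfrak g)$; $\mathcal S(\mathfrak g)$ denotes the set of normal states. Let $\Phi,\Psi:\mathcal B(\mathfrak h)\to\mathcal B(\mathfrak g)$ be quantum channels (normal, completely positive, unital maps) that are completely majorized by the trace: for some $\lambda>0$ the map $\sigma\mapsto\lambda(\operatorname{Tr}\sigma)1-\Phi(\sigma)$, from trace class operators on $\mathfrak h$ to $\mathcal B(\mathfrak g)$, is completely positive, and likewise for $\Psi$. Put $\mathcal H=\mathfrak g\otimes\mathfrak h$ (Hilbert space tensor product), and let $\Phi_\tau,\Psi_\tau\ge 0$ be the operational densities, i.e. the bounded positive operators on $\mathcal H$ with $\Phi(B)=\operatorname{Tr}_{\mathfrak h}[(1\otimes B^{\top})\Phi_\tau]$ and $\Psi(B)=\operatorname{Tr}_{\mathfrak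 h}[(1\otimes B^{\top})\Psi_\tau]$ for all $B\in\mathcal B(\mathfrak h)$. Let $$f(\Phi,\Psi)=\inf_{\varrho\in\mathcal S(\mathfrak g)}\ \sup_{\Upsilon\in\mathcal B(\mathcal H):\,\Upsilon^\dagger\Upsilon=\Psi_\tau}\frac{\operatorname{Re}\operatorname{Tr}\big[\Upsilon(\rho\otimes 1)\Phi_\tau^{1/2}\big]}{\sqrt{\varrho(\Phi(1))}\sqrt{\varrho(\Psi(1))}}$$ be the minimax fidelity. Let $\Phi_\intercal$ denote the predual map, $(\Phi(B),\rho)=(B,\Phi_\intercal(\rho))$, and let $F(\rho,\sigma)=\operatorname{Tr}(\rho^{1/2}\sigma\rho^{1/2})^{1/2}$ be the Uhlmann fidelity. Then all the objects below are well defined ($\Phi_\tau,\Psi_\tau,\Phi_\intercal,\Psi_\intercal$ exist, $\Phi_\intercal\otimes\mathrm{id}(|\upsilon\rangle\langle\upsilon|)$ and $\Psi_\intercal\otimes\mathrm{id}(|\upsilon\rangle\langle\upsilon|)$ are density operators, the operators under the traces are trace class, and the series of scalars converge absolutely), and: 1. $$f(\Phi,\Psi)=\inf_{\varrho\in\mathcal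 S(\mathfrak g)}\ \sup_{\{F_j\},\{V_j\}}\Big|\sum_j\varrho(F_j^\dagger V_j)\Big|,$$ where the supremum is over all Kraus decompositions $\Phi(B)=\sum_jF_j^\dagger BF_j$, $\Psi(B)=\sum_jV_j^\dagger BV_j$ (strongly convergent sums, $F_j,V_j:\mathfrak g\to\mathfrak h$ bounded) indexed by the index set of an orthonormal basis of $\mathcal H$. 2. $$f(\Phi,\Psi)=\inf_{\upsilon\in\mathfrak g\otimes\mathfrak g,\ \|\upsilon\|=1}F\big(\Phi_\intercal\otimes\mathrm{id}(|\upsilon\rangle\langle\upsilon|),\ \Psi_\intercal\otimes\mathrm{id}(|\upsilon\rangle\langle\upsilon|)\big).$$ 3. $$f(\Phi,\Psi)=\inf_{\varrho\in\mathcal S(\mathfrak g)}\ \sup_{F,V}\big|\operatorname{Tr}(F\rho V^\dagger)\big|,$$ where the supremum is over all bounded $F,V:\mathfrak g\to\mathfrak h\otimes\mathcal H$ that give Stinespring decompositions $\Phi(B)=F^\dagger(B\otimes 1_{\mathcal H})F$, $\Psi(B)=V^\dagger(B\otimes 1_{\mathcal H})V$. 4. For every choice of such Stinespring operators $F,V:\mathfrak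 g\to\mathfrak h\otimes\mathcal H$ of $\Phi$ and $\Psi$, $$f(\Phi,\Psi)=\inf_{\varrho\in\mathcal S(\mathfrak g)}\big\|\operatorname{Tr}_{\mathfrak h}(F\rho V^\dagger)\big\|_1 .$$ (Infima and suprema are taken in the extended reals.) -/

import Mathlib

open scoped InnerProductSpace InnerProduct TensorProduct CStarAlgebra

noncomputable section

namespace MinimaxFidelity

/-! ### Trace class operators -/

section Trace

variable {E : Type*} [NormedAddCommGroup E] [InnerProductSpace ℂ E] [CompleteSpace E]

variable (E) in
/-- The index set of a fixed complete orthonormal basis of `E`. -/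
def basisSet : Set E := (exists_hilbertBasis ℂ E).choose

variable (E) in
/-- A fixed complete orthonormal basis of `E`. -/
def stdBasis : HilbertBasis (basisSet E) ℂ E := (exists_hilbertBasis ℂ E).choose_spec.choose

/-- The trace norm `Tr |T|`, `|T| = (T† T)^{1/2}`, with values in `[0, ∞]`. -/
def traceNorm (T : E →L[ℂ] E) : ENNReal :=
  ∑' i, ENNReal.ofReal (RCLike.re ⟪stdBasis E i, CFC.abs T (stdBasis E i)⟫_ℂ)

/-- `T` is a trace class operator. -/
def IsTraceClass (T : E →L[ℂ] E) : Prop := traceNorm T ≠ ⊤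

/-- The trace `Tr T`; it is meant for trace class `T`, where the series converges absolutely
and does not depend on the basis. -/
def opTrace (T : E →L[ℂ] E) : ℂ := ∑' i, ⟪stdBasis E i, T (stdBasis E i)⟫_ℂ

/-- Density operators: positive trace class operators of unit trace. -/
structure IsDensity (ρ : E →L[ℂ] E) : Prop where
  nonneg : 0 ≤ ρ
  traceClass : IsTraceClass ρ
  trace_eq_one : opTrace ρ = 1

/-- The Uhlmann fidelity `F(ρ, σ) = Tr (ρ^{1/2} σ ρ^{1/2})^{1/2}`. -/
def fidelity (ρ σ : E →L[ℂ] E) : ℝ :=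
  (opTrace (CFC.sqrt (CFC.sqrt ρ * σ * CFC.sqrt ρ))).re

variable (E) in
/-- The ultraweak topology of `B(E)`: the coarsest topology for which all the functionals
`B ↦ Tr (B σ)`, `σ` of trace class, are continuous. -/
@[reducible] def ultraweak : TopologicalSpace (E →L[ℂ] E) :=
  ⨅ σ : {σ : E →L[ℂ] E // IsTraceClass σ},
    TopologicalSpace.induced (fun B => opTrace (B * σ.1)) inferInstance

end Trace

/-! ### Hilbert tensor products -/

section Tensor

variable {E F E' F' : Type*}
  [NormedAddCommGroup E] [InnerProductSpace ℂ E] [NormedAddCommGroup F] [InnerProductSpace ℂ F]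
  [NormedAddCommGroup E'] [InnerProductSpace ℂ E']
  [NormedAddCommGroup F'] [InnerProductSpace ℂ F']

variable (E F) in
/-- The Hilbert space tensor product: the completion of the algebraic one. -/
abbrev HTensor : Type _ := UniformSpace.Completion (E ⊗[ℂ] F)

/-- The map `η ↦ ξ ⊗ η`. -/
def insertFst (ξ : E) : F →L[ℂ] HTensor E F :=
  UniformSpace.Completion.toComplL.comp (TensorProduct.mkL ℂ E F ξ)

/-- The map `ξ ↦ ξ ⊗ η`. -/
def insertSnd (η : F) : E →L[ℂ] HTensor E F :=
  UniformSpace.Completion.toComplL.comp ((TensorProduct.mkL ℂ E F).flip η)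

/-- The tensor product `A ⊗ B` of bounded operators. -/
def tensorOp (A : E →L[ℂ] E') (B : F →L[ℂ] F') : HTensor E F →L[ℂ] HTensor E' F' :=
  (TensorProduct.mapL A B).completion

variable [CompleteSpace E] [CompleteSpace F]

/-- `T` is the partial trace of `Y` over the second factor:
`⟨ξ, T ξ'⟩ = ∑ₖ ⟨ξ ⊗ eₖ, Y (ξ' ⊗ eₖ)⟩` for all `ξ`, `ξ'`. -/
def IsPartialTraceSnd (Y : HTensor E F →L[ℂ] HTensor E F) (T : E →L[ℂ] E) : Prop :=
  ∀ ξ ξ' : E,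
    IsTraceClass ((insertFst ξ : F →L[ℂ] HTensor E F)† ∘L Y ∘L insertFst ξ') ∧
    ⟪ξ, T ξ'⟫_ℂ = opTrace ((insertFst ξ : F →L[ℂ] HTensor E F)† ∘L Y ∘L insertFst ξ')

/-- `T` is the partial trace of `Y` over the first factor:
`⟨η, T η'⟩ = ∑ₖ ⟨eₖ ⊗ η, Y (eₖ ⊗ η')⟩` for all `η`, `η'`. -/
def IsPartialTraceFst (Y : HTensor E F →L[ℂ] HTensor E F) (T : F →L[ℂ] F) : Prop :=
  ∀ η η' : F,
    IsTraceClass ((insertSnd η : E →L[ℂ] HTensor E F)† ∘L Y ∘L insertSnd η') ∧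
    ⟪η, T η'⟫_ℂ = opTrace ((insertSnd η : E →L[ℂ] HTensor E F)† ∘L Y ∘L insertSnd η')

open Classical in
/-- The partial trace over the first factor (`0` if it does not exist). -/
def partialTraceFst (Y : HTensor E F →L[ℂ] HTensor E F) : F →L[ℂ] F :=
  if hY : ∃ T, IsPartialTraceFst Y T then hY.choose else 0

end Tensor

/-! ### Conjugations, transposes, and the trace pairing -/

section Pairing

variable {E : Type*} [NormedAddCommGroup E] [InnerProductSpace ℂ E] [CompleteSpace E]

variable (E) in
/-- A complex conjugation of `E`: an antilinear isometric involution. -/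
structure Conjugation where
  toEquiv : E ≃ₗᵢ⋆[ℂ] E
  involutive : ∀ x, toEquiv (toEquiv x) = x

/-- The transpose `J B† J` of `B`. -/
def transpose (J : Conjugation E) (B : E →L[ℂ] E) : E →L[ℂ] E :=
  (J.toEquiv.toContinuousLinearEquiv : E →L⋆[ℂ] E).comp
    ((B†).comp (J.toEquiv.toContinuousLinearEquiv : E →L⋆[ℂ] E))

/-- The trace pairing `(B, ρ) = Tr (B ρᵀ)`. For a density operator `ρ`, the normal state `ϱ` that
corresponds to it is `ϱ(B) = (B, ρ)`. -/
def pairing (J : Conjugation E) (B ρ : E →L[ℂ] E) : ℂ := opTrace (B * transpose J ρ)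

end Pairing

/-! ### Quantum channels from `B(h)` to `B(g)` -/

section Channel

variable {g h : Type*}
  [NormedAddCommGroup g] [InnerProductSpace ℂ g] [CompleteSpace g]
  [NormedAddCommGroup h] [InnerProductSpace ℂ h] [CompleteSpace h]

/-- A completely positive map is a quantum channel if it is normal (ultraweakly continuous)
and unital. -/
structure IsChannel (Φ : (h →L[ℂ] h) →CP (g →L[ℂ] g)) : Prop where
  normal : @Continuous _ _ (ultraweak h) (ultraweak g) Φ
  unital : Φ 1 = 1

/-- `Φ` is completely majorized by the trace: for some `c > 0` the map `σ ↦ c (Tr σ) 1 - Φ(σ)`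
from the trace class operators to `B(g)` is completely positive. -/
def IsCompletelyMajorized (Φ : (h →L[ℂ] h) →CP (g →L[ℂ] g)) : Prop :=
  ∃ c : ℝ, 0 < c ∧ ∀ (k : ℕ) (M : CStarMatrix (Fin k) (Fin k) (h →L[ℂ] h)),
    0 ≤ M → (∀ i j, IsTraceClass (M i j)) →
      0 ≤ M.map (fun σ => ((c : ℂ) * opTrace σ) • (1 : g →L[ℂ] g) - Φ σ)

/-- `D` is the operational density of `Φ`: a bounded positive operator on `g ⊗ h` with
`Φ(B) = Tr_h [(1 ⊗ Bᵀ) D]` for all `B`. -/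
def IsOpDensity (Jh : Conjugation h) (Φ : (h →L[ℂ] h) →CP (g →L[ℂ] g))
    (D : HTensor g h →L[ℂ] HTensor g h) : Prop :=
  0 ≤ D ∧ ∀ B : h →L[ℂ] h, IsPartialTraceSnd (tensorOp 1 (transpose Jh B) ∘L D) (Φ B)

open Classical in
/-- The operational density `Φ_τ` (`0` if it does not exist). -/
def opDensity (Jh : Conjugation h) (Φ : (h →L[ℂ] h) →CP (g →L[ℂ] g)) :
    HTensor g h →L[ℂ] HTensor g h :=
  if hΦ : ∃ D, IsOpDensity Jh Φ D then hΦ.choose else 0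

/-- The minimax fidelity `f(Φ, Ψ)`, the infimum over all normal states `ϱ` on `B(g)` of the
supremum over all bounded `Υ` with `Υ† Υ = Ψ_τ` of
`Re Tr [Φ_τ^{1/2} Υ (ρ ⊗ 1)] / (√ϱ(Φ(1)) √ϱ(Ψ(1)))`. The product under the trace is written in the
cyclic order `Υ (ρ ⊗ 1) Φ_τ^{1/2}`, in which it is of trace class. -/
def minimaxFidelity (Jg : Conjugation g) (Jh : Conjugation h)
    (Φ Ψ : (h →L[ℂ] h) →CP (g →L[ℂ] g)) : EReal :=
  ⨅ (ρ : g →L[ℂ] g) (_ : IsDensity ρ),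
    ⨆ (Υ : HTensor g h →L[ℂ] HTensor g h) (_ : Υ† ∘L Υ = opDensity Jh Ψ),
      (((opTrace (Υ ∘L tensorOp ρ 1 ∘L CFC.sqrt (opDensity Jh Φ))).re /
        (√(pairing Jg (Φ 1) ρ).re * √(pairing Jg (Ψ 1) ρ).re) : ℝ) : EReal)

/-- `σ` is the image `Φ_⊺(ρ)` of `ρ` under the predual map: `(Φ(B), ρ) = (B, σ)` for all `B`. -/
def IsPredual (Jg : Conjugation g) (Jh : Conjugation h) (Φ : (h →L[ℂ] h) →CP (g →L[ℂ] g))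
    (ρ : g →L[ℂ] g) (σ : h →L[ℂ] h) : Prop :=
  IsTraceClass σ ∧ ∀ B : h →L[ℂ] h, pairing Jg (Φ B) ρ = pairing Jh B σ

open Classical in
/-- The predual map `Φ_⊺` (`0` where it does not exist). -/
def predual (Jg : Conjugation g) (Jh : Conjugation h) (Φ : (h →L[ℂ] h) →CP (g →L[ℂ] g))
    (ρ : g →L[ℂ] g) : h →L[ℂ] h :=
  if hρ : ∃ σ, IsPredual Jg Jh Φ ρ σ then hρ.choose else 0

variable {k : Type*} [NormedAddCommGroup k] [InnerProductSpace ℂ k] [CompleteSpace k]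

/-- `θ = (Φ_⊺ ⊗ id)(ω)`: for all `ζ`, `ζ'` in `k`,
`(1 ⊗ ⟨ζ|) θ (1 ⊗ |ζ'⟩) = Φ_⊺ ((1 ⊗ ⟨ζ|) ω (1 ⊗ |ζ'⟩))`. -/
def IsPredualTensorId (Jg : Conjugation g) (Jh : Conjugation h)
    (Φ : (h →L[ℂ] h) →CP (g →L[ℂ] g)) (ω : HTensor g k →L[ℂ] HTensor g k)
    (θ : HTensor h k →L[ℂ] HTensor h k) : Prop :=
  IsTraceClass θ ∧ ∀ ζ ζ' : k,
    (insertSnd ζ : h →L[ℂ] HTensor h k)† ∘L θ ∘L insertSnd ζ' =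
      predual Jg Jh Φ ((insertSnd ζ : g →L[ℂ] HTensor g k)† ∘L ω ∘L insertSnd ζ')

open Classical in
/-- The map `Φ_⊺ ⊗ id` (`0` where it does not exist). -/
def predualTensorId (Jg : Conjugation g) (Jh : Conjugation h)
    (Φ : (h →L[ℂ] h) →CP (g →L[ℂ] g)) (ω : HTensor g k →L[ℂ] HTensor g k) :
    HTensor h k →L[ℂ] HTensor h k :=
  if hω : ∃ θ, IsPredualTensorId Jg Jh Φ ω θ then hω.choose else 0

/-- `{F_j}` is a Kraus decomposition of `Φ`: `Φ(B) = ∑ⱼ F_j† B F_j` in the strong operator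
topology. -/
def IsKraus {J : Type*} (Φ : (h →L[ℂ] h) →CP (g →L[ℂ] g)) (F : J → g →L[ℂ] h) : Prop :=
  ∀ (B : h →L[ℂ] h) (ξ : g), HasSum (fun j => ((F j)† ∘L B ∘L F j) ξ) (Φ B ξ)

/-- `F : g → h ⊗ k` gives a Stinespring decomposition of `Φ`: `Φ(B) = F† (B ⊗ 1) F`. -/
def IsStinespring (Φ : (h →L[ℂ] h) →CP (g →L[ℂ] g)) (F : g →L[ℂ] HTensor h k) : Prop :=
  ∀ B : h →L[ℂ] h, Φ B = F† ∘L tensorOp B (1 : k →L[ℂ] k) ∘L F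

end Channel

end MinimaxFidelity

end

open MinimaxFidelity

/-! Each formula is the infimum over densities `ρ` of one quantity, `overlap`: the trace norm of
`Ψ_τ^{1/2} (ρ ⊗ 1) Φ_τ^{1/2}`, possibly at `ρᵀ`, which runs over the same densities. The theorem
thus reduces to pointwise identities in `ρ`.

The trace norm of `Υ (ρ ⊗ 1) Γ†` depends only on `Γ†Γ` and `Υ†Υ` (`traceNorm_comp_adjoint_congr`),
so any roots of the densities may be used (`overlap_eq`). Conversely, the trace norm of `T` is the
supremum of `Re Tr(WT)` over isometries `W` (`traceNorm_le_of_forall_isometry`). The polar part of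
`T` need not extend to an isometry in infinite dimension; Gardner's lemma on sums of unitaries
supplies the approximation.

The bridge to channels is realignment. A Stinespring operator `F : g → h ⊗ k` is the same data as `Γ
: g ⊗ h → k` with `Γ†Γ = Φ_τ` (`IsStinespring.exists_realignment`, `exists_isStinespring`), and
under it `Tr_h(F ρ V†) = Γ (ρ ⊗ 1) Υ†`. This is formula 4. Taking traces and the supremum gives
formula 3. Slicing `k` along an orthonormal basis turns Stinespring operators into Kraus families
and the trace into the Kraus sum, which is formula 1.

For formula 2, a unit vector `υ` is a Hilbert–Schmidt operator `N` with `N N†` a density. The output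
state is `X†X` with `X = Φ_τ^{1/2}(N ⊗ 1)` up to a flip, and the Uhlmann fidelity is the trace norm
of a product of square roots, which `X` may replace.

Existence of `Φ_τ` uses both hypotheses: complete positivity and majorization make a form on `g ⊗ h`
positive and bounded, and normality extends the density formula from rank-one operators to all `B`.
Trace class facts reduce to Hilbert–Schmidt ones by the balanced factorization
`IsTraceClass.exists_factor`. -/

noncomputable section

namespace MinimaxFidelity

set_option linter.unusedSectionVars false

section Shortcuts

variable {E : Type*} [NormedAddCommGroup E] [InnerProductSpace ℂ E] [CompleteSpace E]

instance : Module ℝ (E →L[ℂ] E) := inferInstance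
instance : Algebra ℝ (E →L[ℂ] E) := inferInstance
instance : NonUnitalContinuousFunctionalCalculus ℝ (E →L[ℂ] E) IsSelfAdjoint := inferInstance
instance : NonnegSpectrumClass ℝ (E →L[ℂ] E) := inferInstance

end Shortcuts

/-! ### Hilbert–Schmidt operators and cyclicity of the trace -/

section HilbertSchmidt

variable {E F G : Type*}
  [NormedAddCommGroup E] [InnerProductSpace ℂ E] [CompleteSpace E]
  [NormedAddCommGroup F] [InnerProductSpace ℂ F] [CompleteSpace F]
  [NormedAddCommGroup G] [InnerProductSpace ℂ G] [CompleteSpace G]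
  {ι κ : Type*}

theorem hasSum_norm_inner_sq (e : HilbertBasis ι ℂ E) (x : E) :
    HasSum (fun i => ‖⟪e i, x⟫_ℂ‖ ^ 2) (‖x‖ ^ 2) := by
  have h := e.hasSum_inner_mul_inner x x
  rw [inner_self_eq_norm_sq_to_K] at h
  have h2 : ∀ i, ⟪x, e i⟫_ℂ * ⟪e i, x⟫_ℂ = ((‖⟪e i, x⟫_ℂ‖ ^ 2 : ℝ) : ℂ) := fun i => by
    rw [← inner_conj_symm, RCLike.conj_mul]
    norm_cast
  simp_rw [h2] at h
  have h3 : ((‖x‖ : ℂ)) ^ 2 = ((‖x‖ ^ 2 : ℝ) : ℂ) := by push_cast; rfl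
  exact Complex.hasSum_ofReal.mp (h3 ▸ h)

theorem enorm_sq_eq_ofReal {V : Type*} [NormedAddCommGroup V] (x : V) : ‖x‖ₑ ^ 2 = ENNReal.ofReal (‖x‖ ^ 2) := by
  rw [ENNReal.ofReal_pow (norm_nonneg _), ofReal_norm]

theorem tsum_enorm_inner_sq (e : HilbertBasis ι ℂ E) (x : E) :
    ∑' i, ‖⟪e i, x⟫_ℂ‖ₑ ^ 2 = ‖x‖ₑ ^ 2 := by
  have h := hasSum_norm_inner_sq e x
  simp_rw [enorm_sq_eq_ofReal]
  rw [← ENNReal.ofReal_tsum_of_nonneg (fun i => by positivity) h.summable, h.tsum_eq]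

/-- Parseval turns both sides into the double series of squared matrix elements, and Tonelli in
`ENNReal` exchanges the sums. Since the two bases are unrelated, this yields basis independence as
well as invariance under adjoints. -/
theorem tsum_enorm_adjoint (e : HilbertBasis ι ℂ E) (f : HilbertBasis κ ℂ F) (A : E →L[ℂ] F) :
    ∑' i, ‖A (e i)‖ₑ ^ 2 = ∑' k, ‖(A†) (f k)‖ₑ ^ 2 := by
  simp_rw [← tsum_enorm_inner_sq f (A _), ← tsum_enorm_inner_sq e ((A†) _)]
  rw [ENNReal.tsum_comm]
  refine tsum_congr fun k => tsum_congr fun i => ?_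
  rw [ContinuousLinearMap.adjoint_inner_right, ← ofReal_norm, ← ofReal_norm,
    norm_inner_symm]

/-- The square of the Hilbert–Schmidt norm. -/
def hsNormSq (A : E →L[ℂ] F) : ENNReal := ∑' i, ‖A (stdBasis E i)‖ₑ ^ 2

theorem hsNormSq_eq (e : HilbertBasis ι ℂ E) (A : E →L[ℂ] F) :
    hsNormSq A = ∑' i, ‖A (e i)‖ₑ ^ 2 := by
  rw [hsNormSq, tsum_enorm_adjoint _ (stdBasis F), tsum_enorm_adjoint e (stdBasis F)]

theorem hsNormSq_adjoint (A : E →L[ℂ] F) : hsNormSq (A†) = hsNormSq A := by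
  rw [hsNormSq, hsNormSq, tsum_enorm_adjoint _ (stdBasis F)]

/-- Hilbert–Schmidt operators. -/
def IsHS (A : E →L[ℂ] F) : Prop := hsNormSq A ≠ ⊤

theorem IsHS.adjoint {A : E →L[ℂ] F} (hA : IsHS A) : IsHS (A†) := by
  rwa [IsHS, hsNormSq_adjoint]

theorem hsNormSq_comp_le (C : F →L[ℂ] G) (A : E →L[ℂ] F) :
    hsNormSq (C ∘L A) ≤ ‖C‖ₑ ^ 2 * hsNormSq A := by
  rw [hsNormSq, hsNormSq, ← ENNReal.tsum_mul_left]
  refine ENNReal.tsum_le_tsum fun i => ?_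
  rw [← mul_pow]
  gcongr
  exact C.le_opENorm _

theorem hsNormSq_comp_le' (A : F →L[ℂ] G) (C : E →L[ℂ] F) :
    hsNormSq (A ∘L C) ≤ ‖C‖ₑ ^ 2 * hsNormSq A := by
  rw [← hsNormSq_adjoint, ContinuousLinearMap.adjoint_comp, ← hsNormSq_adjoint A]
  refine (hsNormSq_comp_le _ _).trans_eq ?_
  rw [← ofReal_norm, ← ofReal_norm, LinearIsometryEquiv.norm_map]

theorem enorm_sq_le_one {C : E →L[ℂ] F} (hC : ‖C‖ ≤ 1) : ‖C‖ₑ ^ 2 ≤ 1 := by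
  rw [enorm_sq_eq_ofReal, ENNReal.ofReal_le_one]
  exact pow_le_one₀ (norm_nonneg _) hC

theorem IsHS.comp_left {A : E →L[ℂ] F} (hA : IsHS A) (C : F →L[ℂ] G) : IsHS (C ∘L A) :=
  ((hsNormSq_comp_le C A).trans_lt (ENNReal.mul_lt_top (by finiteness) hA.lt_top)).ne

theorem IsHS.comp_right {A : F →L[ℂ] G} (hA : IsHS A) (C : E →L[ℂ] F) : IsHS (A ∘L C) :=
  ((hsNormSq_comp_le' A C).trans_lt (ENNReal.mul_lt_top (by finiteness) hA.lt_top)).ne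

theorem IsHS.summable_norm_sq {A : E →L[ℂ] F} (hA : IsHS A) (e : HilbertBasis ι ℂ E) :
    Summable fun i => ‖A (e i)‖ ^ 2 := by
  rw [IsHS, hsNormSq_eq e] at hA
  simp_rw [enorm_sq_eq_ofReal] at hA
  exact (ENNReal.summable_toReal hA).congr fun i => ENNReal.toReal_ofReal (by positivity)

theorem norm_inner_le_half (x y : E) : ‖⟪x, y⟫_ℂ‖ ≤ (‖x‖ ^ 2 + ‖y‖ ^ 2) / 2 := by
  have := norm_inner_le_norm (𝕜 := ℂ) x y
  nlinarith [sq_nonneg (‖x‖ - ‖y‖)]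

theorem IsHS.summable_norm_inner {A B : E →L[ℂ] F} (hA : IsHS A) (hB : IsHS B)
    (e : HilbertBasis ι ℂ E) : Summable fun i => ‖⟪A (e i), B (e i)⟫_ℂ‖ :=
  (((hA.summable_norm_sq e).add (hB.summable_norm_sq e)).div_const 2).of_nonneg_of_le
    (fun _ => norm_nonneg _) fun _ => norm_inner_le_half _ _

theorem IsHS.summable_prod {A : E →L[ℂ] F} (hA : IsHS A) (e : HilbertBasis ι ℂ E)
    (f : HilbertBasis κ ℂ F) : Summable fun p : ι × κ => ‖⟪f p.2, A (e p.1)⟫_ℂ‖ ^ 2 := by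
  have h : ∑' p : ι × κ, ‖⟪f p.2, A (e p.1)⟫_ℂ‖ₑ ^ 2 ≠ ⊤ := by
    rw [ENNReal.tsum_prod (f := fun i k => ‖⟪f k, A (e i)⟫_ℂ‖ₑ ^ 2)]
    simp_rw [tsum_enorm_inner_sq]
    rwa [← hsNormSq_eq e]
  simp_rw [enorm_sq_eq_ofReal] at h
  exact (ENNReal.summable_toReal h).congr fun i => ENNReal.toReal_ofReal (by positivity)

/-- Both sides are iterated sums of one double series, absolutely summable by the
arithmetic–geometric mean inequality. This is the source of cyclicity of the trace. -/
theorem tsum_inner_adjoint {A B : E →L[ℂ] F} (hA : IsHS A) (hB : IsHS B)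
    (e : HilbertBasis ι ℂ E) (f : HilbertBasis κ ℂ F) :
    ∑' i, ⟪A (e i), B (e i)⟫_ℂ = ∑' k, ⟪(B†) (f k), (A†) (f k)⟫_ℂ := by
  have hs : Summable fun p : ι × κ => ⟪A (e p.1), f p.2⟫_ℂ * ⟪f p.2, B (e p.1)⟫_ℂ := by
    refine Summable.of_norm ((((hA.summable_prod e f).add
      (hB.summable_prod e f)).div_const 2).of_nonneg_of_le (fun _ => norm_nonneg _) fun p => ?_)
    rw [norm_mul, norm_inner_symm (A _)]
    nlinarith [sq_nonneg (‖⟪f p.2, A (e p.1)⟫_ℂ‖ - ‖⟪f p.2, B (e p.1)⟫_ℂ‖)]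
  have h1 : ∀ i, ⟪A (e i), B (e i)⟫_ℂ = ∑' k, ⟪A (e i), f k⟫_ℂ * ⟪f k, B (e i)⟫_ℂ :=
    fun i => (f.tsum_inner_mul_inner _ _).symm
  have h2 : ∀ k, ⟪(B†) (f k), (A†) (f k)⟫_ℂ = ∑' i, ⟪A (e i), f k⟫_ℂ * ⟪f k, B (e i)⟫_ℂ := by
    intro k
    rw [← e.tsum_inner_mul_inner]
    refine tsum_congr fun i => ?_
    rw [ContinuousLinearMap.adjoint_inner_left, ContinuousLinearMap.adjoint_inner_right, mul_comm]
  simp_rw [h1, h2]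
  exact Summable.tsum_comm hs.prod_symm

theorem opTrace_adjoint_comp {A B : E →L[ℂ] F} (hA : IsHS A) (hB : IsHS B)
    (e : HilbertBasis ι ℂ E) : opTrace (A† ∘L B) = ∑' i, ⟪A (e i), B (e i)⟫_ℂ := by
  simp only [opTrace, ContinuousLinearMap.comp_apply, ContinuousLinearMap.adjoint_inner_right]
  rw [tsum_inner_adjoint hA hB _ (stdBasis F), tsum_inner_adjoint hA hB e (stdBasis F)]

theorem hasSum_opTrace_adjoint_comp {A B : E →L[ℂ] F} (hA : IsHS A) (hB : IsHS B)
    (e : HilbertBasis ι ℂ E) : HasSum (fun i => ⟪A (e i), B (e i)⟫_ℂ) (opTrace (A† ∘L B)) := by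
  rw [opTrace_adjoint_comp hA hB e]
  exact (hA.summable_norm_inner hB e).of_norm.hasSum

theorem opTrace_adjoint_comp_comm {A B : E →L[ℂ] F} (hA : IsHS A) (hB : IsHS B) :
    opTrace (A† ∘L B) = opTrace (B ∘L A†) := by
  rw [opTrace_adjoint_comp hA hB (stdBasis E), tsum_inner_adjoint hA hB _ (stdBasis F), opTrace]
  simp only [ContinuousLinearMap.comp_apply, ContinuousLinearMap.adjoint_inner_left]

theorem opTrace_comp_comm {A : E →L[ℂ] F} {B : F →L[ℂ] E} (hA : IsHS A) (hB : IsHS B) :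
    opTrace (B ∘L A) = opTrace (A ∘L B) := by
  simpa using opTrace_adjoint_comp_comm hB.adjoint hA

/-- The arithmetic–geometric mean bound replaces Cauchy–Schwarz; it loses nothing on balanced
factors. Working in `ENNReal` removes any summability assumption. -/
theorem enorm_opTrace_adjoint_comp_le {A B : E →L[ℂ] F} :
    2 * ‖opTrace (A† ∘L B)‖ₑ ≤ hsNormSq A + hsNormSq B := by
  rw [hsNormSq, hsNormSq, ← ENNReal.tsum_add, opTrace]
  simp only [ContinuousLinearMap.comp_apply, ContinuousLinearMap.adjoint_inner_right]
  refine (mul_le_mul_right (enorm_tsum_le_tsum_enorm) 2).trans ?_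
  rw [← ENNReal.tsum_mul_left]
  refine ENNReal.tsum_le_tsum fun i => ?_
  rw [enorm_sq_eq_ofReal, enorm_sq_eq_ofReal, ← ENNReal.ofReal_add (by positivity) (by positivity),
    ← ofReal_norm, ← ENNReal.ofReal_ofNat, ← ENNReal.ofReal_mul (by norm_num)]
  refine ENNReal.ofReal_le_ofReal ?_
  linarith [norm_inner_le_half (A (stdBasis E i)) (B (stdBasis E i))]

end HilbertSchmidt

/-! ### Contractive factorizations and the polar decomposition -/

section Contraction

variable {E F G : Type*}
  [NormedAddCommGroup E] [InnerProductSpace ℂ E] [CompleteSpace E]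
  [NormedAddCommGroup F] [InnerProductSpace ℂ F] [CompleteSpace F]
  [NormedAddCommGroup G] [InnerProductSpace ℂ G] [CompleteSpace G]

/-- Douglas' factorization lemma. -/
theorem exists_contraction_of_norm_le (A : E →L[ℂ] F) (B : E →L[ℂ] G)
    (h : ∀ x, ‖B x‖ ≤ ‖A x‖) : ∃ C : F →L[ℂ] G, ‖C‖ ≤ 1 ∧ C ∘L A = B := by
  let K : Submodule ℂ F := (LinearMap.range (A : E →ₗ[ℂ] F)).topologicalClosure
  have : CompleteSpace K := (Submodule.isClosed_topologicalClosure _).completeSpace_coe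
  have hmem : ∀ x, (A : E →ₗ[ℂ] F) x ∈ K := fun x =>
    Submodule.le_topologicalClosure _ (LinearMap.mem_range_self _ x)
  let A' : E →ₗ[ℂ] K := (A : E →ₗ[ℂ] F).codRestrict K hmem
  have hd : DenseRange A' := by
    intro y
    have hy := y.2
    rw [closure_subtype]
    have : ((↑) '' Set.range A' : Set F) = (LinearMap.range (A : E →ₗ[ℂ] F) : Set F) := by
      ext z
      simp [A', Set.mem_image]
    rw [this]
    exact hy
  have hb : ∀ x, ‖(B : E →ₗ[ℂ] G) x‖ ≤ 1 * ‖A' x‖ := fun x => by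
    rw [one_mul]; exact h x
  -- `A x ↦ B x` extends continuously to the closure of the range of `A`, and by zero to its
  -- orthogonal complement.
  refine ⟨(LinearMap.extendOfNorm (B : E →ₗ[ℂ] G) A') ∘L K.orthogonalProjectionOnto, ?_, ?_⟩
  · refine (ContinuousLinearMap.opNorm_comp_le _ _).trans ?_
    refine mul_le_one₀ (LinearMap.opNorm_extendOfNorm_le hd zero_le_one hb) (norm_nonneg _) ?_
    exact Submodule.orthogonalProjectionOnto_norm_le K
  · ext x
    have h1 : K.orthogonalProjectionOnto (A x) = A' x :=
      Submodule.orthogonalProjectionOnto_mem_subspace_eq_self (A' x)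
    rw [ContinuousLinearMap.comp_apply, ContinuousLinearMap.comp_apply, h1]
    exact LinearMap.extendOfNorm_eq hd ⟨1, hb⟩ x

/-- Expanding `‖C†Cy - y‖²` gives at most `‖y‖² - 2‖Cy‖² + ‖y‖² = 0`. -/
theorem adjoint_apply_apply_of_norm_eq {C : F →L[ℂ] G} (hC : ‖C‖ ≤ 1) {y : F}
    (hy : ‖C y‖ = ‖y‖) : (C†) (C y) = y := by
  have h1 : ‖(C†) (C y)‖ ≤ ‖y‖ := by
    refine ((C†).le_of_opNorm_le (c := 1) (by rwa [LinearIsometryEquiv.norm_map]) _).trans ?_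
    rw [one_mul, hy]
  have h2 := @norm_sub_sq ℂ F _ _ _ ((C†) (C y)) y
  rw [ContinuousLinearMap.adjoint_inner_left, inner_self_eq_norm_sq, hy] at h2
  have h3 : ‖(C†) (C y) - y‖ ^ 2 ≤ 0 := by nlinarith [norm_nonneg ((C†) (C y))]
  have h4 : ‖(C†) (C y) - y‖ = 0 := by nlinarith [norm_nonneg ((C†) (C y) - y)]
  exact sub_eq_zero.1 (norm_eq_zero.1 h4)

/-- The contraction is isometric on the range of `A`, so its adjoint inverts it there. These two
identities are all that is used of partial isometries. -/
theorem exists_contraction_of_norm_eq (A : E →L[ℂ] F) (B : E →L[ℂ] G)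
    (h : ∀ x, ‖B x‖ = ‖A x‖) :
    ∃ C : F →L[ℂ] G, ‖C‖ ≤ 1 ∧ C ∘L A = B ∧ C† ∘L B = A := by
  obtain ⟨C, hC, rfl⟩ := exists_contraction_of_norm_le A B fun x => (h x).le
  exact ⟨C, hC, rfl, ContinuousLinearMap.ext fun x => adjoint_apply_apply_of_norm_eq hC (h x)⟩

theorem norm_eq_of_adjoint_comp_eq {A : E →L[ℂ] F} {B : E →L[ℂ] G} (h : B† ∘L B = A† ∘L A)
    (x : E) : ‖B x‖ = ‖A x‖ := by
  have h1 := B.apply_norm_sq_eq_inner_adjoint_left x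
  have h2 := A.apply_norm_sq_eq_inner_adjoint_left x
  rw [h, ← h2] at h1
  exact (sq_eq_sq₀ (norm_nonneg _) (norm_nonneg _)).1 h1

theorem adjoint_eq_self_of_nonneg {A : E →L[ℂ] E} (hA : 0 ≤ A) : A† = A :=
  (IsSelfAdjoint.of_nonneg hA).star_eq

theorem sqrt_adjoint (A : E →L[ℂ] E) : (CFC.sqrt A)† = CFC.sqrt A :=
  adjoint_eq_self_of_nonneg (CFC.sqrt_nonneg A)

theorem sqrt_adjoint_comp_sqrt {A : E →L[ℂ] E} (hA : 0 ≤ A) :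
    (CFC.sqrt A)† ∘L CFC.sqrt A = A := by
  rw [sqrt_adjoint]
  exact CFC.sqrt_mul_sqrt_self A hA

theorem abs_adjoint_comp_abs (T : E →L[ℂ] E) : (CFC.abs T)† ∘L CFC.abs T = T† ∘L T := by
  rw [adjoint_eq_self_of_nonneg (CFC.abs_nonneg T)]
  exact CFC.abs_mul_abs T

theorem exists_polar (T : E →L[ℂ] E) :
    ∃ U : E →L[ℂ] E, ‖U‖ ≤ 1 ∧ U ∘L CFC.abs T = T ∧ U† ∘L T = CFC.abs T :=
  exists_contraction_of_norm_eq _ _ fun x =>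
    norm_eq_of_adjoint_comp_eq (abs_adjoint_comp_abs T).symm x

theorem norm_adjoint_le_one {C : E →L[ℂ] F} (hC : ‖C‖ ≤ 1) : ‖C†‖ ≤ 1 := by
  rwa [LinearIsometryEquiv.norm_map]

end Contraction

/-! ### Trace class operators, trace norm, densities and fidelity -/

section TraceClass

variable {E F G : Type*}
  [NormedAddCommGroup E] [InnerProductSpace ℂ E] [CompleteSpace E]
  [NormedAddCommGroup F] [InnerProductSpace ℂ F] [CompleteSpace F]
  [NormedAddCommGroup G] [InnerProductSpace ℂ G] [CompleteSpace G]
  {ι κ : Type*}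

theorem enorm_sqrt_apply_sq {A : E →L[ℂ] E} (hA : 0 ≤ A) (x : E) :
    ‖CFC.sqrt A x‖ₑ ^ 2 = ENNReal.ofReal (RCLike.re ⟪x, A x⟫_ℂ) := by
  rw [enorm_sq_eq_ofReal, ContinuousLinearMap.apply_norm_sq_eq_inner_adjoint_right,
    sqrt_adjoint_comp_sqrt hA]

theorem traceNorm_eq_hsNormSq (T : E →L[ℂ] E) : traceNorm T = hsNormSq (CFC.sqrt (CFC.abs T)) := by
  simp_rw [traceNorm, hsNormSq, enorm_sqrt_apply_sq (CFC.abs_nonneg T)]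

theorem hsNormSq_adjoint_comp_eq {A : E →L[ℂ] F} {B : E →L[ℂ] G} (h : B† ∘L B = A† ∘L A) :
    hsNormSq B = hsNormSq A := by
  refine tsum_congr fun i => ?_
  rw [enorm_sq_eq_ofReal, enorm_sq_eq_ofReal, norm_eq_of_adjoint_comp_eq h]

/-- With `U` the polar part, `|A†B| = U†A†B = (AU)†B`, whose diagonal entries are bounded termwise
by the arithmetic–geometric mean inequality; `AU` has no larger Hilbert–Schmidt norm than `A`. -/
theorem two_mul_traceNorm_adjoint_comp_le (A B : E →L[ℂ] F) :
    2 * traceNorm (A† ∘L B) ≤ hsNormSq A + hsNormSq B := by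
  obtain ⟨U, hU, -, hU2⟩ := exists_polar (A† ∘L B)
  have h : CFC.abs (A† ∘L B) = (A ∘L U)† ∘L B := by
    rw [ContinuousLinearMap.adjoint_comp, ContinuousLinearMap.comp_assoc, hU2]
  have h2 : hsNormSq (A ∘L U) ≤ hsNormSq A :=
    (hsNormSq_comp_le' A U).trans (mul_le_of_le_one_left' (enorm_sq_le_one hU))
  refine le_trans ?_ (add_le_add_left h2 _)
  rw [traceNorm, h, hsNormSq, hsNormSq, ← ENNReal.tsum_add, ← ENNReal.tsum_mul_left]
  refine ENNReal.tsum_le_tsum fun i => ?_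
  simp_rw [enorm_sq_eq_ofReal]
  rw [← ENNReal.ofReal_add (by positivity) (by positivity), ← ENNReal.ofReal_ofNat,
    ← ENNReal.ofReal_mul (by norm_num)]
  refine ENNReal.ofReal_le_ofReal ?_
  rw [ContinuousLinearMap.comp_apply, ContinuousLinearMap.adjoint_inner_right]
  linarith [norm_inner_le_half ((A ∘L U) (stdBasis E i)) (B (stdBasis E i)),
    RCLike.re_le_norm ⟪(A ∘L U) (stdBasis E i), B (stdBasis E i)⟫_ℂ]

theorem isTraceClass_adjoint_comp {A B : E →L[ℂ] F} (hA : IsHS A) (hB : IsHS B) :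
    IsTraceClass (A† ∘L B) := by
  have h := (two_mul_traceNorm_adjoint_comp_le A B).trans_lt
    (ENNReal.add_lt_top.2 ⟨hA.lt_top, hB.lt_top⟩)
  exact (ENNReal.lt_top_of_mul_ne_top_right h.ne (by norm_num)).ne

theorem isTraceClass_comp {A : E →L[ℂ] F} {B : F →L[ℂ] E} (hA : IsHS A) (hB : IsHS B) :
    IsTraceClass (B ∘L A) := by
  simpa using isTraceClass_adjoint_comp hB.adjoint hA

/-- `T = U|T| = (S U†)† S` with `S = |T|^{1/2}`. The factors are balanced, so the bounds by
`hsNormSq A + hsNormSq B` recover the sharp constant `2 ‖T‖₁`. -/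
theorem IsTraceClass.exists_factor {T : E →L[ℂ] E} (hT : IsTraceClass T) :
    ∃ A B : E →L[ℂ] E, IsHS A ∧ IsHS B ∧ T = A† ∘L B ∧
      hsNormSq A ≤ traceNorm T ∧ hsNormSq B ≤ traceNorm T := by
  obtain ⟨U, hU, hU1, -⟩ := exists_polar T
  set S := CFC.sqrt (CFC.abs T)
  have hS : IsHS S := by rwa [IsHS, ← traceNorm_eq_hsNormSq]
  refine ⟨S ∘L U†, S, hS.comp_right _, hS, ?_, ?_, (traceNorm_eq_hsNormSq T).ge⟩
  · rw [ContinuousLinearMap.adjoint_comp, ContinuousLinearMap.adjoint_adjoint,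
      ContinuousLinearMap.comp_assoc, sqrt_adjoint_comp_sqrt (CFC.abs_nonneg T), hU1]
  · rw [traceNorm_eq_hsNormSq]
    refine (hsNormSq_comp_le' _ _).trans ?_
    exact mul_le_of_le_one_left' (enorm_sq_le_one (norm_adjoint_le_one hU))

theorem enorm_opTrace_le (T : E →L[ℂ] E) : ‖opTrace T‖ₑ ≤ traceNorm T := by
  by_cases hT : IsTraceClass T
  · obtain ⟨A, B, -, -, h, hA, hB⟩ := hT.exists_factor
    have h2 := (enorm_opTrace_adjoint_comp_le (A := A) (B := B)).trans (add_le_add hA hB)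
    rw [← h, ← two_mul] at h2
    exact (ENNReal.mul_le_mul_iff_right (by norm_num) (by norm_num)).1 h2
  · rw [IsTraceClass, not_not] at hT
    simp [hT]

theorem IsTraceClass.summable_norm {T : E →L[ℂ] E} (hT : IsTraceClass T)
    (e : HilbertBasis ι ℂ E) : Summable fun i => ‖⟪e i, T (e i)⟫_ℂ‖ := by
  obtain ⟨A, B, hA, hB, h, -, -⟩ := hT.exists_factor
  simpa [h, ContinuousLinearMap.adjoint_inner_right] using hA.summable_norm_inner hB e

theorem IsTraceClass.hasSum {T : E →L[ℂ] E} (hT : IsTraceClass T) (e : HilbertBasis ι ℂ E) :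
    HasSum (fun i => ⟪e i, T (e i)⟫_ℂ) (opTrace T) := by
  obtain ⟨A, B, hA, hB, h, -, -⟩ := hT.exists_factor
  simpa [h, ContinuousLinearMap.adjoint_inner_right] using hasSum_opTrace_adjoint_comp hA hB e

theorem IsTraceClass.comp_comp {T : E →L[ℂ] E} (hT : IsTraceClass T) (C : E →L[ℂ] F)
    (D : F →L[ℂ] E) : IsTraceClass (C ∘L T ∘L D) := by
  obtain ⟨A, B, hA, hB, rfl, -, -⟩ := hT.exists_factor
  have := isTraceClass_comp (hB.comp_right D) (hA.adjoint.comp_left C)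
  exact this

theorem IsTraceClass.comp_left {T : E →L[ℂ] E} (hT : IsTraceClass T) (C : E →L[ℂ] E) :
    IsTraceClass (C ∘L T) := hT.comp_comp C (.id ℂ E)

theorem IsTraceClass.comp_right {T : E →L[ℂ] E} (hT : IsTraceClass T) (C : E →L[ℂ] E) :
    IsTraceClass (T ∘L C) := hT.comp_comp (.id ℂ E) C

/-- With `T = A†B`, both sides equal `Tr(B D C A†)` by cyclicity for Hilbert–Schmidt factors. -/
theorem IsTraceClass.opTrace_comp_comm {T : E →L[ℂ] E} (hT : IsTraceClass T) (C : E →L[ℂ] F)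
    (D : F →L[ℂ] E) : opTrace (C ∘L T ∘L D) = opTrace (T ∘L D ∘L C) := by
  obtain ⟨A, B, hA, hB, rfl, -, -⟩ := hT.exists_factor
  have h1 := MinimaxFidelity.opTrace_comp_comm (hB.comp_right D) (hA.adjoint.comp_left C)
  have h2 := MinimaxFidelity.opTrace_comp_comm (hB.comp_right (D ∘L C)) hA.adjoint
  exact h1.trans h2.symm

theorem IsTraceClass.opTrace_comm {T : E →L[ℂ] E} (hT : IsTraceClass T) (C : E →L[ℂ] E) :
    opTrace (C ∘L T) = opTrace (T ∘L C) := by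
  simpa using hT.opTrace_comp_comm C (.id ℂ E)

theorem IsTraceClass.smul {T : E →L[ℂ] E} (hT : IsTraceClass T) (c : ℂ) :
    IsTraceClass (c • T) := by
  simpa using hT.comp_left (c • .id ℂ E)

/-- The polar part `U` of the sum gives `|S + T| = U†S + U†T`, and each summand has an absolutely
summable diagonal. -/
theorem IsTraceClass.add {S T : E →L[ℂ] E} (hS : IsTraceClass S) (hT : IsTraceClass T) :
    IsTraceClass (S + T) := by
  obtain ⟨U, -, -, hU⟩ := exists_polar (S + T)
  rw [ContinuousLinearMap.comp_add] at hU
  have h := ((hS.comp_left (U†)).summable_norm (stdBasis E)).add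
    ((hT.comp_left (U†)).summable_norm (stdBasis E))
  rw [IsTraceClass, traceNorm, ← hU]
  refine ((ENNReal.tsum_le_tsum fun i => ?_).trans_lt (h.tsum_ofReal_lt_top)).ne
  refine ENNReal.ofReal_le_ofReal ?_
  rw [add_apply, inner_add_right]
  exact (RCLike.re_le_norm _).trans (norm_add_le _ _)

theorem isTraceClass_zero : IsTraceClass (0 : E →L[ℂ] E) := by
  simp [IsTraceClass, traceNorm]

theorem opTrace_smul (c : ℂ) (T : E →L[ℂ] E) : opTrace (c • T) = c * opTrace T := by
  simp [opTrace, tsum_mul_left]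

theorem opTrace_add {S T : E →L[ℂ] E} (hS : IsTraceClass S) (hT : IsTraceClass T) :
    opTrace (S + T) = opTrace S + opTrace T := by
  rw [← ((hS.hasSum (stdBasis E)).add (hT.hasSum (stdBasis E))).tsum_eq, opTrace]
  simp

theorem traceNorm_comp_comp_le (T : E →L[ℂ] E) {C : E →L[ℂ] F} {D : F →L[ℂ] E}
    (hC : ‖C‖ ≤ 1) (hD : ‖D‖ ≤ 1) : traceNorm (C ∘L T ∘L D) ≤ traceNorm T := by
  by_cases hT : IsTraceClass T
  · obtain ⟨A, B, -, -, h, hA, hB⟩ := hT.exists_factor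
    have h1 := two_mul_traceNorm_adjoint_comp_le (A ∘L C†) (B ∘L D)
    have h2 : hsNormSq (A ∘L C†) ≤ hsNormSq A := (hsNormSq_comp_le' _ _).trans
      (mul_le_of_le_one_left' (enorm_sq_le_one (norm_adjoint_le_one hC)))
    have h3 : hsNormSq (B ∘L D) ≤ hsNormSq B := (hsNormSq_comp_le' _ _).trans
      (mul_le_of_le_one_left' (enorm_sq_le_one hD))
    have h4 : (A ∘L C†)† ∘L (B ∘L D) = C ∘L T ∘L D := by
      rw [ContinuousLinearMap.adjoint_comp, ContinuousLinearMap.adjoint_adjoint, h]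
      rfl
    have h5 := h1.trans (add_le_add (h2.trans hA) (h3.trans hB))
    rw [h4, ← two_mul] at h5
    exact (ENNReal.mul_le_mul_iff_right (by norm_num) (by norm_num)).1 h5
  · rw [IsTraceClass, not_not] at hT
    simp [hT]

theorem traceNorm_eq_of_comp_comp {S : E →L[ℂ] E} {T : F →L[ℂ] F} {C C' : E →L[ℂ] F}
    {D D' : F →L[ℂ] E} (hC : ‖C‖ ≤ 1) (hC' : ‖C'‖ ≤ 1) (hD : ‖D‖ ≤ 1) (hD' : ‖D'‖ ≤ 1)
    (h : C ∘L S ∘L D = T) (h' : D' ∘L T ∘L C' = S) : traceNorm S = traceNorm T := by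
  refine le_antisymm ?_ ?_
  · rw [← h']; exact traceNorm_comp_comp_le T hD' hC'
  · rw [← h]; exact traceNorm_comp_comp_le S hC hD

theorem traceNorm_adjoint_le (T : E →L[ℂ] E) : traceNorm (T†) ≤ traceNorm T := by
  obtain ⟨U, hU, hU1, hU2⟩ := exists_polar T
  have h : T† = U† ∘L T ∘L U† := by
    rw [← ContinuousLinearMap.comp_assoc, hU2]
    conv_lhs => rw [← hU1, ContinuousLinearMap.adjoint_comp,
      adjoint_eq_self_of_nonneg (CFC.abs_nonneg T)]
  rw [h]
  exact traceNorm_comp_comp_le T (norm_adjoint_le_one hU) (norm_adjoint_le_one hU)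

theorem traceNorm_adjoint (T : E →L[ℂ] E) : traceNorm (T†) = traceNorm T :=
  le_antisymm (traceNorm_adjoint_le T) (by simpa using traceNorm_adjoint_le (T†))

/-- The trace norm of a product `B A†` depends only on `A† A` and `B† B`. -/
theorem traceNorm_comp_adjoint_congr {A : G →L[ℂ] E} {A' : G →L[ℂ] F} {B : G →L[ℂ] E}
    {B' : G →L[ℂ] F} (X : G →L[ℂ] G) (hA : A† ∘L A = A'† ∘L A') (hB : B† ∘L B = B'† ∘L B') :
    traceNorm (B ∘L X ∘L A†) = traceNorm (B' ∘L X ∘L A'†) := by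
  -- `U` and `V` carry `A` to `A'` and `B` to `B'`, and their adjoints carry them back. Each product
  -- is thus the other one flanked by contractions, so neither trace norm exceeds the other.
  obtain ⟨U, hU, hU1, hU2⟩ := exists_contraction_of_norm_eq A A' fun x =>
    norm_eq_of_adjoint_comp_eq hA.symm x
  obtain ⟨V, hV, hV1, hV2⟩ := exists_contraction_of_norm_eq B B' fun x =>
    norm_eq_of_adjoint_comp_eq hB.symm x
  refine traceNorm_eq_of_comp_comp (C := V) (D := U†) (D' := V†) (C' := U) hV hU
    (norm_adjoint_le_one hU) (norm_adjoint_le_one hV) ?_ ?_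
  · rw [← hU1, ← hV1, ContinuousLinearMap.adjoint_comp]
    rfl
  · rw [← hU2, ← hV2, ContinuousLinearMap.adjoint_comp, ContinuousLinearMap.adjoint_adjoint]
    rfl

theorem opTrace_eq_tsum_re {P : E →L[ℂ] E} (hP : 0 ≤ P) (hP' : IsTraceClass P) :
    HasSum (fun i => RCLike.re ⟪stdBasis E i, P (stdBasis E i)⟫_ℂ) (opTrace P).re ∧
      (opTrace P).im = 0 := by
  have h := hP'.hasSum (stdBasis E)
  refine ⟨RCLike.reCLM.hasSum h, ?_⟩
  have h2 := (RCLike.imCLM (K := ℂ)).hasSum h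
  refine h2.unique ?_
  convert hasSum_zero with i
  exact (RCLike.nonneg_iff.1 (((ContinuousLinearMap.nonneg_iff_isPositive _).1
    hP).inner_nonneg_right (stdBasis E i))).2

theorem ofReal_opTrace_re {P : E →L[ℂ] E} (hP : 0 ≤ P) (hP' : IsTraceClass P) :
    ENNReal.ofReal (opTrace P).re =
      ∑' i, ENNReal.ofReal (RCLike.re ⟪stdBasis E i, P (stdBasis E i)⟫_ℂ) := by
  have h := (opTrace_eq_tsum_re hP hP').1
  rw [← h.tsum_eq, ENNReal.ofReal_tsum_of_nonneg _ h.summable]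
  exact fun i => (((ContinuousLinearMap.nonneg_iff_isPositive _).1
    hP).re_inner_nonneg_right (stdBasis E i))

theorem opTrace_re_nonneg {P : E →L[ℂ] E} (hP : 0 ≤ P) (hP' : IsTraceClass P) :
    0 ≤ (opTrace P).re :=
  (opTrace_eq_tsum_re hP hP').1.nonneg fun i => (((ContinuousLinearMap.nonneg_iff_isPositive _).1
    hP).re_inner_nonneg_right (stdBasis E i))

theorem IsTraceClass.abs {T : E →L[ℂ] E} (hT : IsTraceClass T) : IsTraceClass (CFC.abs T) := by
  rwa [IsTraceClass, traceNorm, CFC.cfcAbs_cfcAbs]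

theorem IsTraceClass.opTrace_abs {T : E →L[ℂ] E} (hT : IsTraceClass T) :
    opTrace (CFC.abs T) = ((traceNorm T).toReal : ℂ) := by
  have h := ofReal_opTrace_re (CFC.abs_nonneg T) hT.abs
  apply Complex.ext
  · rw [Complex.ofReal_re, traceNorm, ← h, ENNReal.toReal_ofReal]
    exact opTrace_re_nonneg (CFC.abs_nonneg T) hT.abs
  · rw [Complex.ofReal_im]
    exact (opTrace_eq_tsum_re (CFC.abs_nonneg T) hT.abs).2

theorem adjoint_comp_self_nonneg (A : E →L[ℂ] F) : 0 ≤ A† ∘L A :=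
  (ContinuousLinearMap.nonneg_iff_isPositive _).2 (ContinuousLinearMap.isPositive_adjoint_comp_self A)

theorem IsHS.opTrace_adjoint_comp_self {A : E →L[ℂ] F} (hA : IsHS A) :
    opTrace (A† ∘L A) = ((hsNormSq A).toReal : ℂ) := by
  have hA' := isTraceClass_adjoint_comp hA hA
  have h := ofReal_opTrace_re (adjoint_comp_self_nonneg A) hA'
  have h2 : ∀ i, ENNReal.ofReal (RCLike.re ⟪stdBasis E i, (A† ∘L A) (stdBasis E i)⟫_ℂ) =
      ‖A (stdBasis E i)‖ₑ ^ 2 := fun i => by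
    rw [enorm_sq_eq_ofReal, A.apply_norm_sq_eq_inner_adjoint_right]
  simp_rw [h2] at h
  apply Complex.ext
  · rw [Complex.ofReal_re, hsNormSq, ← h, ENNReal.toReal_ofReal]
    exact opTrace_re_nonneg (adjoint_comp_self_nonneg A) hA'
  · rw [Complex.ofReal_im]
    exact (opTrace_eq_tsum_re (adjoint_comp_self_nonneg A) hA').2

theorem traceNorm_adjoint_comp_self (A : E →L[ℂ] F) : traceNorm (A† ∘L A) = hsNormSq A := by
  rw [traceNorm, CFC.abs_of_nonneg _ (adjoint_comp_self_nonneg A), hsNormSq]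
  refine tsum_congr fun i => ?_
  rw [enorm_sq_eq_ofReal, A.apply_norm_sq_eq_inner_adjoint_right]

theorem isDensity_adjoint_comp_self {A : E →L[ℂ] F} (hA : hsNormSq A = 1) :
    IsDensity (A† ∘L A) := by
  have h : IsHS A := by simp [IsHS, hA]
  exact ⟨adjoint_comp_self_nonneg A, isTraceClass_adjoint_comp h h,
    by rw [h.opTrace_adjoint_comp_self, hA]; simp⟩

theorem IsDensity.hsNormSq_sqrt {ρ : E →L[ℂ] E} (hρ : IsDensity ρ) :
    hsNormSq (CFC.sqrt ρ) = 1 := by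
  have h1 := traceNorm_adjoint_comp_self (CFC.sqrt ρ)
  rw [sqrt_adjoint_comp_sqrt hρ.nonneg] at h1
  have h2 : IsHS (CFC.sqrt ρ) := by rw [IsHS, ← h1]; exact hρ.traceClass
  have h3 := h2.opTrace_adjoint_comp_self
  rw [sqrt_adjoint_comp_sqrt hρ.nonneg, hρ.trace_eq_one] at h3
  have h4 : (hsNormSq (CFC.sqrt ρ)).toReal = 1 := by exact_mod_cast h3.symm
  simpa [ENNReal.toReal_eq_one_iff] using h4

/-- `ρ^{1/2} σ ρ^{1/2}` is the square of `|σ^{1/2} ρ^{1/2}|`, so the fidelity is the trace norm of a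
product of roots. -/
theorem fidelity_eq (ρ σ : E →L[ℂ] E) (hσ : 0 ≤ σ)
    (h : IsTraceClass (CFC.sqrt σ ∘L CFC.sqrt ρ)) : fidelity ρ σ = (traceNorm (CFC.sqrt σ ∘L CFC.sqrt ρ)).toReal := by
  have h1 : CFC.sqrt ρ * σ * CFC.sqrt ρ =
      star (CFC.sqrt σ * CFC.sqrt ρ) * (CFC.sqrt σ * CFC.sqrt ρ) := by
    rw [star_mul, (IsSelfAdjoint.of_nonneg (CFC.sqrt_nonneg ρ)).star_eq,
      (IsSelfAdjoint.of_nonneg (CFC.sqrt_nonneg σ)).star_eq, mul_assoc, mul_assoc,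
      ← mul_assoc (CFC.sqrt σ), CFC.sqrt_mul_sqrt_self σ hσ]
  have h2 := h.opTrace_abs
  rw [fidelity, h1]
  exact congrArg Complex.re h2

end TraceClass

/-! ### The trace norm as a supremum over isometries -/

section Unitary

/-- Gardner's lemma: the sum of a unitary and a strict contraction is a sum of two unitaries. -/
theorem exists_unitary_add_unitary {A : Type*} [CStarAlgebra A] [PartialOrder A]
    [StarOrderedRing A] (U : unitary A) {S : A} (hS : ‖S‖ < 1) :
    ∃ V W : unitary A, (V + W : A) = U + S := by
  -- `U + S = U (1 + U*S)` is invertible by the Neumann series. Hence half of it, `X`, has a polar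
  -- decomposition `X = V P` with `V` unitary.
  have hY : IsUnit (1 + star (U : A) * S) := by
    have : ‖-(star (U : A) * S)‖ < 1 := by
      rwa [norm_neg, ← Unitary.coe_star, CStarRing.norm_coe_unitary_mul (star U)]
    simpa using isUnit_one_sub_of_norm_lt_one this
  set X : A := (2⁻¹ : ℂ) • (U + S) with hXdef
  have hX : IsUnit X := by
    have h1 : (U : A) + S = U * (1 + star (U : A) * S) := by
      rw [mul_add, mul_one, ← mul_assoc, Unitary.mul_star_self_of_mem U.2, one_mul]
    rw [hXdef, h1]
    exact ((Unitary.isUnit_coe (U := U)).mul hY).smul (Units.mk0 (2⁻¹ : ℂ) (by norm_num))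
  have hXn : ‖X‖ ≤ 1 := by
    rw [hXdef, norm_smul]
    have h1 : ‖(U : A)‖ ≤ 1 := by
      nontriviality A
      exact (CStarRing.norm_coe_unitary U).le
    have := norm_add_le (U : A) S
    norm_num
    linarith
  set P : A := CFC.abs X
  have hPP : P * P = star X * X := CFC.abs_mul_abs X
  have hPsa : star P = P := (IsSelfAdjoint.of_nonneg (CFC.abs_nonneg X)).star_eq
  have hP : IsUnit P := by
    have h1 : IsUnit (P * P) := hPP ▸ hX.star.mul hX
    exact ((Commute.refl P).isUnit_mul_iff.1 h1).1
  obtain ⟨Q, hQ⟩ := hP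
  have hQQ : P * (↑Q⁻¹ : A) = 1 := by rw [← hQ, Units.mul_inv]
  have hQQ' : (↑Q⁻¹ : A) * P = 1 := by rw [← hQ, Units.inv_mul]
  have hQsa : star (↑Q⁻¹ : A) = ↑Q⁻¹ := by
    calc star (↑Q⁻¹ : A) = star (↑Q⁻¹ : A) * (P * ↑Q⁻¹) := by rw [hQQ, mul_one]
      _ = star (P * (↑Q⁻¹ : A)) * ↑Q⁻¹ := by rw [star_mul, hPsa, mul_assoc]
      _ = ↑Q⁻¹ := by rw [hQQ, star_one, one_mul]
  have hV1 : star (X * (↑Q⁻¹ : A)) * (X * ↑Q⁻¹) = 1 := by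
    calc star (X * (↑Q⁻¹ : A)) * (X * ↑Q⁻¹) = ↑Q⁻¹ * (star X * X) * ↑Q⁻¹ := by
          rw [star_mul, hQsa]; simp only [mul_assoc]
      _ = (↑Q⁻¹ * P) * (P * ↑Q⁻¹) := by rw [← hPP]; simp only [mul_assoc]
      _ = 1 := by rw [hQQ, hQQ', one_mul]
  have hV2 : (X * (↑Q⁻¹ : A)) * star (X * (↑Q⁻¹ : A)) = 1 := by
    have hVu : IsUnit (X * (↑Q⁻¹ : A)) := hX.mul (Q⁻¹).isUnit
    obtain ⟨v, hv⟩ := hVu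
    rw [← hv] at hV1 ⊢
    rw [v.mul_eq_one_iff_eq_inv.1 hV1, Units.mul_inv]
  let V : unitary A := ⟨X * (↑Q⁻¹ : A), Unitary.mem_iff.2 ⟨hV1, hV2⟩⟩
  have hPn : ‖(⟨P, hPsa⟩ : selfAdjoint A)‖ ≤ 1 := by
    change ‖P‖ ≤ 1
    rw [CFC.norm_abs]
    exact hXn
  -- `P` is a self-adjoint contraction, so it is the mean of the unitaries `P ± i (1 - P²)^{1/2}`;
  -- then `U + S = 2 V P = V W + V W*`.
  let W : unitary A := selfAdjoint.unitarySelfAddISMul ⟨P, hPsa⟩ hPn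
  have hW : (W : A) + star (W : A) = (2 : ℂ) • P := by
    change (W : A) + ((star W : unitary A) : A) = _
    rw [show ((star W : unitary A) : A) = _ from selfAdjoint.star_coe_unitarySelfAddISMul _ hPn,
      show (W : A) = _ from selfAdjoint.unitarySelfAddISMul_coe _ hPn]
    rw [two_smul]
    abel
  refine ⟨V * W, V * star W, ?_⟩
  rw [Submonoid.coe_mul, Submonoid.coe_mul, ← mul_add, Unitary.coe_star, hW]
  change X * ↑Q⁻¹ * ((2 : ℂ) • P) = U + S
  rw [mul_smul_comm, mul_assoc, hQQ', mul_one, hXdef, smul_smul]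
  norm_num

variable {E : Type*} [NormedAddCommGroup E] [InnerProductSpace ℂ E] [CompleteSpace E]

/-- The value at the polar contraction `U†` is the trace norm, but `U†` need not be an isometry.
Gardner's lemma bounds the values at all strict contractions by the supremum over unitaries; `r U†`
with `r → 1` then suffices. -/
theorem traceNorm_le_of_forall_isometry {T : E →L[ℂ] E} (hT : IsTraceClass T) {m : ℝ}
    (hm : ∀ W : E →L[ℂ] E, W† ∘L W = 1 → (opTrace (W ∘L T)).re ≤ m) :
    (traceNorm T).toReal ≤ m := by
  set s : Set ℝ := Set.range fun W : unitary (E →L[ℂ] E) => (opTrace ((W : E →L[ℂ] E) ∘L T)).re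
  have hm' : ∀ W : unitary (E →L[ℂ] E), (opTrace ((W : E →L[ℂ] E) ∘L T)).re ≤ m := fun W =>
    hm W (Unitary.star_mul_self_of_mem W.2)
  have hs : BddAbove s := ⟨m, by rintro _ ⟨W, rfl⟩; exact hm' W⟩
  have hne : s.Nonempty := Set.range_nonempty _
  have hsm : sSup s ≤ m := csSup_le hne (by rintro _ ⟨W, rfl⟩; exact hm' W)
  have key : ∀ S : E →L[ℂ] E, ‖S‖ < 1 → (opTrace (S ∘L T)).re ≤ sSup s := by
    intro S hS
    -- For every unitary `U`, `U + S = V + W` gives `Re Tr(UT) + Re Tr(ST) ≤ 2 sup`. Taking the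
    -- supremum over `U` cancels one copy of it.
    have h1 : sSup s ≤ 2 * sSup s - (opTrace (S ∘L T)).re := by
      refine csSup_le hne ?_
      rintro _ ⟨U, rfl⟩
      obtain ⟨V, W, h⟩ := exists_unitary_add_unitary U hS
      have h2 : opTrace ((V : E →L[ℂ] E) ∘L T) + opTrace ((W : E →L[ℂ] E) ∘L T) =
          opTrace ((U : E →L[ℂ] E) ∘L T) + opTrace (S ∘L T) := by
        rw [← opTrace_add (hT.comp_left _) (hT.comp_left _),
          ← opTrace_add (hT.comp_left _) (hT.comp_left _), ← ContinuousLinearMap.add_comp,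
          ← ContinuousLinearMap.add_comp, h]
      have h3 := congrArg Complex.re h2
      rw [Complex.add_re, Complex.add_re] at h3
      have h4 := le_csSup hs ⟨V, rfl⟩
      have h5 := le_csSup hs ⟨W, rfl⟩
      dsimp only at h4 h5 ⊢
      linarith
    linarith
  obtain ⟨U, hU, -, hU2⟩ := exists_polar T
  refine le_trans ?_ hsm
  have h6 : ∀ r : ℝ, r ∈ Set.Ioo (0 : ℝ) 1 → r * (traceNorm T).toReal ≤ sSup s := by
    intro r hr
    have h7 := key ((r : ℂ) • U†) (by
      rw [norm_smul, Complex.norm_real, Real.norm_of_nonneg hr.1.le, LinearIsometryEquiv.norm_map]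
      exact (mul_le_of_le_one_right hr.1.le hU).trans_lt hr.2)
    rwa [ContinuousLinearMap.smul_comp, hU2, opTrace_smul, hT.opTrace_abs, ← Complex.ofReal_mul,
      Complex.ofReal_re] at h7
  have h8 : Filter.Tendsto (fun r : ℝ => r * (traceNorm T).toReal) (nhdsWithin 1 (Set.Iio 1))
      (nhds (1 * (traceNorm T).toReal)) :=
    ((continuous_id.mul continuous_const).tendsto _).mono_left nhdsWithin_le_nhds
  rw [one_mul] at h8
  exact le_of_tendsto h8 (Filter.eventually_of_mem (Ioo_mem_nhdsLT zero_lt_one) h6)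

end Unitary

/-! ### Rank-one operators -/

section RankOne

variable {E F : Type*}
  [NormedAddCommGroup E] [InnerProductSpace ℂ E] [CompleteSpace E]
  [NormedAddCommGroup F] [InnerProductSpace ℂ F] [CompleteSpace F]

theorem isHS_innerSL (y : E) : IsHS (innerSL ℂ y) := by
  rw [IsHS, hsNormSq]
  simp only [innerSL_apply_apply]
  simp_rw [fun i => show ‖⟪y, stdBasis E i⟫_ℂ‖ₑ = ‖⟪stdBasis E i, y⟫_ℂ‖ₑ by
    rw [← ofReal_norm, ← ofReal_norm, norm_inner_symm]]
  rw [tsum_enorm_inner_sq]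
  finiteness

theorem isTraceClass_rankOne (x y : E) : IsTraceClass (InnerProductSpace.rankOne ℂ x y) := by
  rw [InnerProductSpace.rankOne_def']
  refine isTraceClass_comp (isHS_innerSL y) ?_
  have h : ContinuousLinearMap.toSpanSingleton ℂ x = (innerSL ℂ x)† := by
    rw [ContinuousLinearMap.adjoint_innerSL_apply]
  rw [h]
  exact (isHS_innerSL x).adjoint

theorem opTrace_rankOne (x y : E) : opTrace (InnerProductSpace.rankOne ℂ x y) = ⟪y, x⟫_ℂ := by
  rw [← (stdBasis E).tsum_inner_mul_inner, opTrace]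
  refine tsum_congr fun i => ?_
  rw [InnerProductSpace.rankOne_apply, inner_smul_right]

theorem opTrace_comp_rankOne (T : E →L[ℂ] E) (x y : E) :
    opTrace (T ∘L InnerProductSpace.rankOne ℂ x y) = ⟪y, T x⟫_ℂ := by
  rw [InnerProductSpace.comp_rankOne, opTrace_rankOne]

theorem eq_of_opTrace_comp_eq {S T : E →L[ℂ] E}
    (h : ∀ B : E →L[ℂ] E, opTrace (S ∘L B) = opTrace (T ∘L B)) : S = T := by
  refine ContinuousLinearMap.ext fun x => ext_inner_left ℂ fun y => ?_
  rw [← opTrace_comp_rankOne, h, opTrace_comp_rankOne]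

end RankOne

/-! ### Hilbert tensor products and slices of vectors -/

section Tensor

variable {E F E' F' E'' F'' G : Type*}
  [NormedAddCommGroup E] [InnerProductSpace ℂ E] [NormedAddCommGroup F] [InnerProductSpace ℂ F]
  [NormedAddCommGroup E'] [InnerProductSpace ℂ E']
  [NormedAddCommGroup F'] [InnerProductSpace ℂ F']
  [NormedAddCommGroup E''] [InnerProductSpace ℂ E'']
  [NormedAddCommGroup F''] [InnerProductSpace ℂ F'']
  [NormedAddCommGroup G] [InnerProductSpace ℂ G]
  {ι κ : Type*}

theorem insertFst_apply (ξ : E) (η : F) :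
    insertFst ξ η = ((ξ ⊗ₜ[ℂ] η : E ⊗[ℂ] F) : HTensor E F) := rfl

theorem insertSnd_apply (ξ : E) (η : F) : insertSnd η ξ = insertFst ξ η := rfl

theorem inner_insertFst (ξ ξ' : E) (η η' : F) :
    ⟪insertFst ξ η, insertFst ξ' η'⟫_ℂ = ⟪ξ, ξ'⟫_ℂ * ⟪η, η'⟫_ℂ := by
  rw [insertFst_apply, insertFst_apply, UniformSpace.Completion.inner_coe,
    TensorProduct.inner_tmul]

theorem insertFst_add (ξ ξ' : E) :
    (insertFst (ξ + ξ') : F →L[ℂ] HTensor E F) = insertFst ξ + insertFst ξ' := by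
  rw [insertFst, map_add, ContinuousLinearMap.comp_add]; rfl

theorem insertFst_smul (c : ℂ) (ξ : E) :
    (insertFst (c • ξ) : F →L[ℂ] HTensor E F) = c • insertFst ξ := by
  rw [insertFst, map_smul, ContinuousLinearMap.comp_smul]; rfl

theorem HTensor.dense_span :
    Dense (Submodule.span ℂ (Set.range fun p : E × F => (insertFst p.1 p.2 : HTensor E F)) :
      Set (HTensor E F)) := by
  refine (UniformSpace.Completion.denseRange_coe (α := E ⊗[ℂ] F)).mono ?_
  rintro _ ⟨z, rfl⟩
  induction z using TensorProduct.induction_on with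
  | zero => exact Submodule.zero_mem _
  | tmul x y => exact Submodule.subset_span ⟨(x, y), rfl⟩
  | add x y hx hy =>
    rw [UniformSpace.Completion.coe_add]
    exact Submodule.add_mem _ hx hy

theorem HTensor.clm_ext {V : Type*} [NormedAddCommGroup V] [NormedSpace ℂ V]
    {S T : HTensor E F →L[ℂ] V} (h : ∀ ξ η, S (insertFst ξ η) = T (insertFst ξ η)) : S = T :=
  ContinuousLinearMap.ext_on HTensor.dense_span (by rintro _ ⟨p, rfl⟩; exact h p.1 p.2)

theorem HTensor.ext_inner {x y : HTensor E F}
    (h : ∀ ξ η, ⟪insertFst ξ η, x⟫_ℂ = ⟪insertFst ξ η, y⟫_ℂ) : x = y := by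
  have h1 : innerSL ℂ x = innerSL ℂ y := HTensor.clm_ext fun ξ η => by
    rw [innerSL_apply_apply, innerSL_apply_apply, ← inner_conj_symm, h, inner_conj_symm]
  exact ext_inner_right ℂ fun z => by simpa using congrArg (fun f => f z) h1

theorem tensorOp_insertFst (A : E →L[ℂ] E') (B : F →L[ℂ] F') (ξ : E) (η : F) :
    tensorOp A B (insertFst ξ η) = insertFst (A ξ) (B η) := by
  rw [insertFst_apply, tensorOp, ContinuousLinearMap.completion_apply_coe, TensorProduct.mapL_tmul]
  rfl

theorem tensorOp_comp_insertFst (A : E →L[ℂ] E') (B : F →L[ℂ] F') (ξ : E) :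
    tensorOp A B ∘L insertFst ξ = insertFst (A ξ) ∘L B :=
  ContinuousLinearMap.ext fun η => tensorOp_insertFst A B ξ η

theorem tensorOp_comp_insertSnd (A : E →L[ℂ] E') (B : F →L[ℂ] F') (η : F) :
    tensorOp A B ∘L insertSnd η = insertSnd (B η) ∘L A :=
  ContinuousLinearMap.ext fun ξ => tensorOp_insertFst A B ξ η

theorem tensorOp_comp (A : E' →L[ℂ] E'') (B : F' →L[ℂ] F'') (A' : E →L[ℂ] E') (B' : F →L[ℂ] F') :
    tensorOp A B ∘L tensorOp A' B' = tensorOp (A ∘L A') (B ∘L B') :=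
  HTensor.clm_ext fun ξ η => by
    simp only [ContinuousLinearMap.comp_apply, tensorOp_insertFst]

theorem tensorOp_one_one : tensorOp (1 : E →L[ℂ] E) (1 : F →L[ℂ] F) = 1 :=
  HTensor.clm_ext fun ξ η => by rw [tensorOp_insertFst]; rfl

theorem tensorOp_adjoint [CompleteSpace E] [CompleteSpace F] [CompleteSpace E'] [CompleteSpace F']
    (A : E →L[ℂ] E') (B : F →L[ℂ] F') : (tensorOp A B)† = tensorOp (A†) (B†) :=
  HTensor.clm_ext fun ξ η => HTensor.ext_inner fun ξ' η' => by
    rw [ContinuousLinearMap.adjoint_inner_right, tensorOp_insertFst, tensorOp_insertFst,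
      inner_insertFst, inner_insertFst, ContinuousLinearMap.adjoint_inner_right,
      ContinuousLinearMap.adjoint_inner_right]

variable (E F) in
/-- The flip `η ⊗ ξ ↦ ξ ⊗ η`. -/
def tensorSwap : HTensor F E →L[ℂ] HTensor E F :=
  ((TensorProduct.commIsometry ℂ F E).toContinuousLinearEquiv : F ⊗[ℂ] E →L[ℂ] E ⊗[ℂ] F).completion

theorem tensorSwap_insertFst (ξ : E) (η : F) : tensorSwap E F (insertFst η ξ) = insertFst ξ η := by
  rw [insertFst_apply, tensorSwap, ContinuousLinearMap.completion_apply_coe]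
  rfl

theorem tensorSwap_comp_tensorSwap : tensorSwap E F ∘L tensorSwap F E = 1 :=
  HTensor.clm_ext fun ξ η => by
    simp only [ContinuousLinearMap.comp_apply, tensorSwap_insertFst]; rfl

variable [CompleteSpace E] [CompleteSpace F] [CompleteSpace G]

theorem adjoint_insertFst_apply (ξ ξ' : E) (η : F) :
    ((insertFst ξ : F →L[ℂ] HTensor E F)†) (insertFst ξ' η) = ⟪ξ, ξ'⟫_ℂ • η :=
  ext_inner_left ℂ fun η' => by
    rw [ContinuousLinearMap.adjoint_inner_right, inner_insertFst, inner_smul_right]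

theorem adjoint_insertSnd_apply (η η' : F) (ξ : E) :
    ((insertSnd η : E →L[ℂ] HTensor E F)†) (insertFst ξ η') = ⟪η, η'⟫_ℂ • ξ :=
  ext_inner_left ℂ fun ξ' => by
    rw [ContinuousLinearMap.adjoint_inner_right, insertSnd_apply, inner_insertFst,
      inner_smul_right, mul_comm]

theorem adjoint_tensorSwap : (tensorSwap E F)† = tensorSwap F E :=
  HTensor.clm_ext fun ξ η => HTensor.ext_inner fun ξ' η' => by
    rw [ContinuousLinearMap.adjoint_inner_right, tensorSwap_insertFst, tensorSwap_insertFst,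
      inner_insertFst, inner_insertFst, mul_comm]

theorem adjoint_insertSnd_comp_tensorOp [CompleteSpace E'] [CompleteSpace F']
    (A : E →L[ℂ] E') (B : F →L[ℂ] F') (η : F') :
    (insertSnd η : E' →L[ℂ] HTensor E' F')† ∘L tensorOp A B =
      A ∘L (insertSnd ((B†) η) : E →L[ℂ] HTensor E F)† := by
  rw [← ContinuousLinearMap.adjoint_adjoint (tensorOp A B), ← ContinuousLinearMap.adjoint_comp,
    tensorOp_adjoint, tensorOp_comp_insertSnd, ContinuousLinearMap.adjoint_comp,
    ContinuousLinearMap.adjoint_adjoint]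

theorem adjoint_insertFst_comp_tensorOp [CompleteSpace E'] [CompleteSpace F']
    (A : E →L[ℂ] E') (B : F →L[ℂ] F') (ξ : E') :
    (insertFst ξ : F' →L[ℂ] HTensor E' F')† ∘L tensorOp A B =
      B ∘L (insertFst ((A†) ξ) : F →L[ℂ] HTensor E F)† := by
  rw [← ContinuousLinearMap.adjoint_adjoint (tensorOp A B), ← ContinuousLinearMap.adjoint_comp,
    tensorOp_adjoint, tensorOp_comp_insertFst, ContinuousLinearMap.adjoint_comp,
    ContinuousLinearMap.adjoint_adjoint]

theorem insertFst_comp_adjoint_insertFst (ξ ξ' : E) :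
    (insertFst ξ : F →L[ℂ] HTensor E F) ∘L (insertFst ξ' : F →L[ℂ] HTensor E F)† =
      tensorOp (InnerProductSpace.rankOne ℂ ξ ξ') 1 :=
  HTensor.clm_ext fun x η => by
    rw [ContinuousLinearMap.comp_apply, adjoint_insertFst_apply, tensorOp_insertFst,
      InnerProductSpace.rankOne_apply, insertFst_smul, map_smul]
    rfl

theorem orthonormal_insertFst (e : HilbertBasis ι ℂ E) (f : HilbertBasis κ ℂ F) :
    Orthonormal ℂ fun p : ι × κ => (insertFst (e p.1) (f p.2) : HTensor E F) :=
  (e.orthonormal.tmul f.orthonormal).comp_linearIsometry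
    (UniformSpace.Completion.toComplₗᵢ (𝕜 := ℂ) (E := E ⊗[ℂ] F))

/-- The product of two orthonormal bases. -/
def tensorBasis (e : HilbertBasis ι ℂ E) (f : HilbertBasis κ ℂ F) :
    HilbertBasis (ι × κ) ℂ (HTensor E F) :=
  HilbertBasis.mkOfOrthogonalEqBot (orthonormal_insertFst e f) (by
    rw [Submodule.eq_bot_iff]
    intro x hx
    have h0 : ∀ i k, ⟪insertFst (e i) (f k), x⟫_ℂ = 0 := fun i k =>
      (Submodule.mem_orthogonal _ _).1 hx _ (Submodule.subset_span ⟨(i, k), rfl⟩)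
    have h1 : ∀ i, ((insertFst (e i) : F →L[ℂ] HTensor E F)†) x = 0 := fun i => by
      refine f.repr.injective (lp.ext (funext fun k => ?_))
      rw [f.repr_apply_apply, ContinuousLinearMap.adjoint_inner_right, h0, map_zero]
      rfl
    refine HTensor.ext_inner fun ξ η => ?_
    rw [inner_zero_right, ← insertSnd_apply, ← ContinuousLinearMap.adjoint_inner_right]
    have h2 : ((insertSnd η : E →L[ℂ] HTensor E F)†) x = 0 := by
      refine e.repr.injective (lp.ext (funext fun i => ?_))
      rw [e.repr_apply_apply, ContinuousLinearMap.adjoint_inner_right, insertSnd_apply,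
        ← ContinuousLinearMap.adjoint_inner_right, h1, inner_zero_right, map_zero]
      rfl
    rw [h2, inner_zero_right])

theorem tensorBasis_apply (e : HilbertBasis ι ℂ E) (f : HilbertBasis κ ℂ F) (p : ι × κ) :
    tensorBasis e f p = insertFst (e p.1) (f p.2) := by
  rw [tensorBasis, HilbertBasis.coe_mkOfOrthogonalEqBot]

/-- Parseval for the slices `(1 ⊗ ⟨f k|) x`: group the product basis by its second index. Thus `E ⊗
F` is the `ℓ²` sum of copies of `E`, and a vector is determined by its slices. -/
theorem tsum_enorm_adjoint_insertSnd (f : HilbertBasis κ ℂ F) (x : HTensor E F) :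
    ∑' k, ‖((insertSnd (f k) : E →L[ℂ] HTensor E F)†) x‖ₑ ^ 2 = ‖x‖ₑ ^ 2 := by
  rw [← tsum_enorm_inner_sq (tensorBasis (stdBasis E) f) x]
  simp_rw [← tsum_enorm_inner_sq (stdBasis E) (((insertSnd (f _) : E →L[ℂ] HTensor E F)†) x),
    ContinuousLinearMap.adjoint_inner_right, tensorBasis_apply, insertSnd_apply]
  rw [ENNReal.tsum_comm, ENNReal.tsum_prod
    (f := fun i k => ‖⟪insertFst (stdBasis E i) (f k), x⟫_ℂ‖ₑ ^ 2)]

theorem HTensor.ext_insertSnd (f : HilbertBasis κ ℂ F) {x y : HTensor E F}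
    (h : ∀ k, ((insertSnd (f k) : E →L[ℂ] HTensor E F)†) x =
      ((insertSnd (f k) : E →L[ℂ] HTensor E F)†) y) : x = y := by
  have h1 := tsum_enorm_adjoint_insertSnd f (x - y)
  simp_rw [map_sub, h, sub_self] at h1
  have h2 : ‖x - y‖ₑ = 0 := by simpa using h1.symm
  exact sub_eq_zero.1 (enorm_eq_zero.1 h2)

theorem norm_insertSnd (η : F) (ξ : E) : ‖(insertSnd η ξ : HTensor E F)‖ = ‖ξ‖ * ‖η‖ := by
  rw [insertSnd_apply, insertFst_apply, UniformSpace.Completion.norm_coe,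
    TensorProduct.norm_tmul]

/-- The copies `E ⊗ f k` form an orthogonal family, so every square-summable family is the family of
slices of a vector. -/
theorem HTensor.hasSum_of_summable (f : HilbertBasis κ ℂ F) {y : κ → E}
    (hy : Summable fun k => ‖y k‖ ^ 2) :
    ∃ x : HTensor E F, HasSum (fun k => insertSnd (f k) (y k)) x ∧
      ∀ k, ((insertSnd (f k) : E →L[ℂ] HTensor E F)†) x = y k := by
  let V : κ → E →ₗᵢ[ℂ] HTensor E F := fun k =>
    ⟨((insertSnd (f k) : E →L[ℂ] HTensor E F) : E →ₗ[ℂ] HTensor E F), fun ξ => by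
      have := norm_insertSnd (f k) ξ
      rw [f.orthonormal.1 k, mul_one] at this
      exact this⟩
  have hV : OrthogonalFamily ℂ (fun _ : κ => E) V := fun i j hij ξ ξ' => by
    change ⟪insertFst ξ (f i), insertFst ξ' (f j)⟫_ℂ = 0
    rw [inner_insertFst, f.orthonormal.2 hij, mul_zero]
  have hs : Summable fun k => V k (y k) := (hV.summable_iff_norm_sq_summable y).2 hy
  refine ⟨_, hs.hasSum, fun k => ?_⟩
  have h1 := (((insertSnd (f k) : E →L[ℂ] HTensor E F)†)).hasSum hs.hasSum
  refine h1.unique ?_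
  convert hasSum_single k ?_ using 1
  · change y k = ((insertSnd (f k) : E →L[ℂ] HTensor E F)†) (insertFst (y k) (f k))
    rw [adjoint_insertSnd_apply, inner_self_eq_norm_sq_to_K, f.orthonormal.1 k]
    simp
  · intro j hj
    change ((insertSnd (f k) : E →L[ℂ] HTensor E F)†) (insertFst (y j) (f j)) = 0
    rw [adjoint_insertSnd_apply, f.orthonormal.2 hj.symm, zero_smul]

theorem HTensor.hasSum_insertSnd (f : HilbertBasis κ ℂ F) (x : HTensor E F) :
    HasSum (fun k => insertSnd (f k) (((insertSnd (f k) : E →L[ℂ] HTensor E F)†) x)) x := by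
  have h : Summable fun k => ‖((insertSnd (f k) : E →L[ℂ] HTensor E F)†) x‖ ^ 2 := by
    have h1 := tsum_enorm_adjoint_insertSnd f x
    simp_rw [enorm_sq_eq_ofReal] at h1
    exact (ENNReal.summable_toReal (h1.trans_ne ENNReal.ofReal_ne_top)).congr fun i =>
      ENNReal.toReal_ofReal (by positivity)
  obtain ⟨y, hy, hy'⟩ := HTensor.hasSum_of_summable f h
  rwa [HTensor.ext_insertSnd f hy'] at hy

/-- A row of operators is an operator into the tensor product. -/
theorem exists_adjoint_insertSnd_comp_eq (f : HilbertBasis κ ℂ F) (A : κ → G →L[ℂ] E)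
    (hA : ∀ ξ, HasSum (fun k => ‖A k ξ‖ ^ 2) (‖ξ‖ ^ 2)) :
    ∃ T : G →L[ℂ] HTensor E F, ∀ k, (insertSnd (f k) : E →L[ℂ] HTensor E F)† ∘L T = A k := by
  choose T hT using fun ξ => HTensor.hasSum_of_summable f (hA ξ).summable
  -- Linearity is checked slice by slice; the bound `1` is Parseval combined with `hA`.
  refine ⟨LinearMap.mkContinuous
    { toFun := T
      map_add' := fun x y => HTensor.ext_insertSnd f fun k => by
        rw [map_add, (hT _).2, (hT _).2, (hT _).2, map_add]
      map_smul' := fun c x => HTensor.ext_insertSnd f fun k => by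
        rw [RingHom.id_apply, map_smul, (hT _).2, (hT _).2, map_smul] } 1 fun x => ?_, fun k => ?_⟩
  · have h1 := tsum_enorm_adjoint_insertSnd f (T x)
    simp_rw [(hT x).2, enorm_sq_eq_ofReal] at h1
    rw [← ENNReal.ofReal_tsum_of_nonneg (fun _ => by positivity) (hA x).summable,
      (hA x).tsum_eq] at h1
    have h2 := (ENNReal.ofReal_eq_ofReal_iff (by positivity) (by positivity)).1 h1
    rw [one_mul]
    exact ((sq_eq_sq₀ (norm_nonneg _) (norm_nonneg _)).1 h2).ge
  · exact ContinuousLinearMap.ext fun x => (hT x).2 k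

end Tensor

/-! ### Conjugations and transposes -/

section Conjugation

variable {E F : Type*} [NormedAddCommGroup E] [InnerProductSpace ℂ E] [CompleteSpace E]
  [NormedAddCommGroup F] [InnerProductSpace ℂ F] [CompleteSpace F]
  (J : Conjugation E) {ι : Type*}

instance : CoeFun (Conjugation E) fun _ => E → E := ⟨fun J => J.toEquiv⟩

theorem Conjugation.apply_apply (x : E) : J (J x) = x := J.involutive x

theorem Conjugation.norm_apply (x : E) : ‖J x‖ = ‖x‖ := J.toEquiv.norm_map x

theorem Conjugation.map_smul (c : ℂ) (x : E) : J (c • x) = starRingEnd ℂ c • J x :=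
  J.toEquiv.map_smulₛₗ c x

theorem Conjugation.map_add (x y : E) : J (x + y) = J x + J y := _root_.map_add J.toEquiv x y

/-- Polarization: norms are preserved, and antilinearity exchanges the two terms containing `i`. -/
theorem Conjugation.inner_apply (x y : E) : ⟪J x, J y⟫_ℂ = ⟪y, x⟫_ℂ := by
  rw [← inner_conj_symm y x, inner_eq_sum_norm_sq_div_four, inner_eq_sum_norm_sq_div_four,
    map_div₀]
  have hI : ∀ x y : E, ‖J x + (RCLike.I : ℂ) • J y‖ = ‖x - (RCLike.I : ℂ) • y‖ := fun x y => by
    rw [← J.norm_apply (x - _), sub_eq_add_neg, J.map_add, ← neg_smul, J.map_smul]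
    simp
  have hI' : ∀ x y : E, ‖J x - (RCLike.I : ℂ) • J y‖ = ‖x + (RCLike.I : ℂ) • y‖ := fun x y => by
    rw [← J.norm_apply (x + _), J.map_add, J.map_smul, sub_eq_add_neg]
    simp
  rw [hI, hI', ← J.map_add, J.norm_apply]
  have h2 : ‖J x - J y‖ = ‖x - y‖ := by
    rw [← J.norm_apply (x - y)]
    exact congrArg _ (_root_.map_sub J.toEquiv x y).symm
  have h4 : (starRingEnd ℂ) 4 = 4 := map_ofNat _ 4
  rw [h2]
  simp [h4]
  ring

theorem Conjugation.inner_apply_left (x y : E) : ⟪J x, y⟫_ℂ = ⟪J y, x⟫_ℂ := by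
  conv_lhs => rw [← J.apply_apply y]
  rw [J.inner_apply]

theorem Conjugation.inner_apply_right (x y : E) : ⟪x, J y⟫_ℂ = ⟪y, J x⟫_ℂ := by
  rw [← inner_conj_symm, J.inner_apply_left, inner_conj_symm]

theorem Conjugation.orthonormal {v : ι → E} (hv : Orthonormal ℂ v) :
    Orthonormal ℂ fun i => J (v i) :=
  ⟨fun i => by rw [J.norm_apply, hv.1], fun i j hij => by
    change ⟪J (v i), J (v j)⟫_ℂ = 0
    rw [J.inner_apply]; exact hv.2 hij.symm⟩

/-- The image of an orthonormal basis under a conjugation. -/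
def Conjugation.basis (e : HilbertBasis ι ℂ E) : HilbertBasis ι ℂ E :=
  HilbertBasis.mkOfOrthogonalEqBot (J.orthonormal e.orthonormal) (by
    rw [Submodule.eq_bot_iff]
    intro x hx
    have h0 : ∀ i, ⟪J (e i), x⟫_ℂ = 0 := fun i =>
      (Submodule.mem_orthogonal _ _).1 hx _ (Submodule.subset_span ⟨i, rfl⟩)
    have h1 : J x = 0 := by
      refine e.repr.injective (lp.ext (funext fun i => ?_))
      rw [e.repr_apply_apply, J.inner_apply_right, ← inner_conj_symm, h0, map_zero, map_zero]
      rfl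
    rw [← J.apply_apply x, h1]
    exact map_zero J.toEquiv)

theorem Conjugation.basis_apply (e : HilbertBasis ι ℂ E) (i : ι) : J.basis e i = J (e i) := by
  rw [Conjugation.basis, HilbertBasis.coe_mkOfOrthogonalEqBot]

theorem transpose_apply (B : E →L[ℂ] E) (x : E) : transpose J B x = J ((B†) (J x)) := rfl

theorem inner_transpose_apply (B : E →L[ℂ] E) (x y : E) :
    ⟪x, transpose J B y⟫_ℂ = ⟪J y, B (J x)⟫_ℂ := by
  rw [transpose_apply, J.inner_apply_right, ContinuousLinearMap.adjoint_inner_left]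

theorem transpose_transpose (B : E →L[ℂ] E) : transpose J (transpose J B) = B :=
  ContinuousLinearMap.ext fun x => ext_inner_left ℂ fun y => by
    rw [inner_transpose_apply, inner_transpose_apply, J.apply_apply, J.apply_apply]

theorem adjoint_transpose (B : E →L[ℂ] E) : (transpose J B)† = transpose J (B†) :=
  ContinuousLinearMap.ext fun x => ext_inner_left ℂ fun y => by
    rw [ContinuousLinearMap.adjoint_inner_right, ← inner_conj_symm, inner_transpose_apply,
      inner_transpose_apply, inner_conj_symm, ContinuousLinearMap.adjoint_inner_right]

theorem transpose_comp (A B : E →L[ℂ] E) :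
    transpose J (A ∘L B) = transpose J B ∘L transpose J A :=
  ContinuousLinearMap.ext fun x => by
    simp only [ContinuousLinearMap.comp_apply, transpose_apply, J.apply_apply,
      ContinuousLinearMap.adjoint_comp]

theorem transpose_one : transpose J (1 : E →L[ℂ] E) = 1 :=
  ContinuousLinearMap.ext fun x => ext_inner_left ℂ fun y => by
    rw [inner_transpose_apply, one_apply_eq_self, J.inner_apply]; rfl

theorem transpose_rankOne (x y : E) : transpose J (InnerProductSpace.rankOne ℂ x y) =
    InnerProductSpace.rankOne ℂ (J y) (J x) :=
  ContinuousLinearMap.ext fun z => by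
    rw [transpose_apply, InnerProductSpace.adjoint_rankOne, InnerProductSpace.rankOne_apply,
      InnerProductSpace.rankOne_apply, J.map_smul, inner_conj_symm, J.inner_apply_left]

/-- Evaluated on the conjugated basis, the transpose has the norms of the adjoint on the original
one. -/
theorem hsNormSq_transpose (B : E →L[ℂ] E) : hsNormSq (transpose J B) = hsNormSq B := by
  rw [← hsNormSq_adjoint B, hsNormSq_eq (J.basis (stdBasis E)), hsNormSq_eq (stdBasis E)]
  refine tsum_congr fun i => ?_
  rw [J.basis_apply, transpose_apply, J.apply_apply, ← ofReal_norm, J.norm_apply, ofReal_norm]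

theorem IsTraceClass.transpose {T : E →L[ℂ] E} (hT : IsTraceClass T) :
    IsTraceClass (transpose J T) := by
  obtain ⟨A, B, hA, hB, rfl, -, -⟩ := hT.exists_factor
  rw [transpose_comp]
  refine isTraceClass_comp ?_ ?_
  · rw [IsHS, hsNormSq_transpose]; exact hA.adjoint
  · rw [IsHS, hsNormSq_transpose]; exact hB

theorem opTrace_transpose {T : E →L[ℂ] E} (hT : IsTraceClass T) :
    opTrace (transpose J T) = opTrace T := by
  rw [← (hT.hasSum (J.basis (stdBasis E))).tsum_eq, opTrace]
  refine tsum_congr fun i => ?_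
  rw [inner_transpose_apply, J.basis_apply]

theorem transpose_nonneg {T : E →L[ℂ] E} (hT : 0 ≤ T) : 0 ≤ transpose J T := by
  have h := sqrt_adjoint_comp_sqrt hT
  rw [← h, transpose_comp, ← ContinuousLinearMap.adjoint_adjoint (transpose J (CFC.sqrt T)),
    adjoint_transpose]
  exact adjoint_comp_self_nonneg _

theorem IsDensity.transpose {ρ : E →L[ℂ] E} (hρ : IsDensity ρ) : IsDensity (transpose J ρ) :=
  ⟨transpose_nonneg J hρ.nonneg, hρ.traceClass.transpose J,
    by rw [opTrace_transpose J hρ.traceClass, hρ.trace_eq_one]⟩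

end Conjugation

/-! ### Normal functionals -/

section Normal

variable {E : Type*} [NormedAddCommGroup E] [InnerProductSpace ℂ E] [CompleteSpace E]

/-- Ultraweakly continuous functionals are given by trace class operators. -/
theorem exists_isTraceClass_of_continuous (φ : (E →L[ℂ] E) →ₗ[ℂ] ℂ)
    (hφ : @Continuous _ _ (ultraweak E) _ φ) :
    ∃ σ : E →L[ℂ] E, IsTraceClass σ ∧ ∀ B, φ B = opTrace (B ∘L σ) := by
  let f : {σ : E →L[ℂ] E // IsTraceClass σ} → (E →L[ℂ] E) →ₗ[ℂ] ℂ := fun σ =>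
    { toFun := fun B => opTrace (B ∘L σ.1)
      map_add' := fun A B => by
        rw [ContinuousLinearMap.add_comp, opTrace_add (σ.2.comp_left A) (σ.2.comp_left B)]
      map_smul' := fun c B => by
        rw [ContinuousLinearMap.smul_comp, opTrace_smul]; rfl }
  -- The ultraweak topology is initial for the functionals `f σ`, so a continuous functional is a
  -- finite linear combination of them.
  have h : φ ∈ Submodule.span ℂ (Set.range f) := (LinearMap.mem_span_iff_continuous φ).2 hφ
  clear hφ
  induction h using Submodule.span_induction with
  | mem x hx =>
    obtain ⟨σ, rfl⟩ := hx
    exact ⟨σ.1, σ.2, fun B => rfl⟩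
  | zero => exact ⟨0, isTraceClass_zero, fun B => by simp [opTrace]⟩
  | add x y _ _ hx hy =>
    obtain ⟨σ, hσ, h1⟩ := hx
    obtain ⟨τ, hτ, h2⟩ := hy
    refine ⟨σ + τ, hσ.add hτ, fun B => ?_⟩
    rw [LinearMap.add_apply, h1, h2, ContinuousLinearMap.comp_add,
      opTrace_add (hσ.comp_left B) (hτ.comp_left B)]
  | smul c x _ hx =>
    obtain ⟨σ, hσ, h1⟩ := hx
    refine ⟨c • σ, hσ.smul c, fun B => ?_⟩
    rw [LinearMap.smul_apply, h1, ContinuousLinearMap.comp_smul, opTrace_smul, smul_eq_mul]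

end Normal

/-! ### Bounded positive forms -/

section Form

open UniformSpace in
/-- A bounded positive semidefinite form on an inner product space is given by a positive operator
on the completion. -/
theorem exists_operator_of_form {V : Type*} [NormedAddCommGroup V] [InnerProductSpace ℂ V]
    (q : V →ₗ⋆[ℂ] V →ₗ[ℂ] ℂ) {c : ℝ} (hc : 0 ≤ c)
    (him : ∀ x, (q x x).im = 0) (hpos : ∀ x, 0 ≤ (q x x).re)
    (hb : ∀ x, (q x x).re ≤ c * ‖x‖ ^ 2) :
    ∃ D : Completion V →L[ℂ] Completion V, 0 ≤ D ∧
      ∀ x y : V, ⟪(x : Completion V), D y⟫_ℂ = q x y := by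
  -- Realness of the form at `x + y` and at `x + i y` gives the imaginary and the real part of
  -- Hermitian symmetry.
  have hsymm : ∀ x y, starRingEnd ℂ (q y x) = q x y := by
    intro x y
    have h1 := him (x + y)
    have h2 := him (x + Complex.I • y)
    have h3 := him y
    have h4 := him x
    simp only [map_add, LinearMap.add_apply, LinearMap.map_smulₛₗ, LinearMap.smul_apply, map_smul,
      Complex.add_im, Complex.add_re, smul_eq_mul, Complex.mul_im, Complex.mul_re, Complex.I_re,
      Complex.I_im, Complex.conj_I, Complex.neg_re, Complex.neg_im] at h1 h2
    apply Complex.ext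
    · rw [Complex.conj_re]; linarith
    · rw [Complex.conj_im]; linarith
  have hcs : ∀ x y, ‖q x y‖ ≤ c * ‖x‖ * ‖y‖ := by
    intro x y
    let C : PreInnerProductSpace.Core ℂ V :=
      { inner := fun x y => q x y
        conj_inner_symm := hsymm
        re_inner_nonneg := hpos
        add_left := fun x y z => by rw [map_add, LinearMap.add_apply]
        smul_left := fun x y r => by rw [LinearMap.map_smulₛₗ, LinearMap.smul_apply, smul_eq_mul] }
    have h1 : ‖q x y‖ * ‖q y x‖ ≤ (q x x).re * (q y y).re :=
      @InnerProductSpace.Core.inner_mul_inner_self_le ℂ V _ _ _ C x y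
    have h2 : ‖q y x‖ = ‖q x y‖ := by rw [← hsymm x y, RCLike.norm_conj]
    rw [h2] at h1
    have h3 : (q x x).re * (q y y).re ≤ (c * ‖x‖ ^ 2) * (c * ‖y‖ ^ 2) :=
      mul_le_mul (hb x) (hb y) (hpos y) (by positivity)
    refine le_of_sq_le_sq ?_ (by positivity)
    nlinarith
  let e : V →ₗ[ℂ] Completion V := (Completion.toComplL : V →L[ℂ] Completion V).toLinearMap
  have he : DenseRange e := Completion.denseRange_coe
  have hen : ∀ x, ‖e x‖ = ‖x‖ := fun x => Completion.norm_coe x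
  have hq : ∀ y x, ‖q y x‖ ≤ (c * ‖y‖) * ‖e x‖ := fun y x => by rw [hen]; exact hcs y x
  -- The Riesz vector of the functional `q y`, extended to the completion by the Cauchy–Schwarz
  -- bound `hcs`.
  let d : V → Completion V := fun y =>
    (InnerProductSpace.toDual ℂ (Completion V)).symm (LinearMap.extendOfNorm (q y) e)
  have hd : ∀ y x : V, ⟪d y, e x⟫_ℂ = q y x := fun y x => by
    rw [InnerProductSpace.toDual_symm_apply]
    exact LinearMap.extendOfNorm_eq he ⟨_, hq y⟩ x
  have hext : ∀ u v : Completion V, (∀ x : V, ⟪u, e x⟫_ℂ = ⟪v, e x⟫_ℂ) → u = v := by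
    intro u v h
    refine ext_inner_right ℂ fun z => ?_
    have h2 : (fun z => ⟪u, z⟫_ℂ) = fun z => ⟪v, z⟫_ℂ :=
      he.equalizer (by fun_prop) (by fun_prop) (funext h)
    exact congrFun h2 z
  let d' : V →ₗ[ℂ] Completion V :=
    { toFun := d
      map_add' := fun y y' => hext _ _ fun x => by
        rw [inner_add_left, hd, hd, hd, map_add, LinearMap.add_apply]
      map_smul' := fun r y => hext _ _ fun x => by
        rw [RingHom.id_apply, inner_smul_left, hd, hd, LinearMap.map_smulₛₗ, LinearMap.smul_apply,
          smul_eq_mul] }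
  have hdn : ∀ y, ‖d' y‖ ≤ c * ‖e y‖ := fun y => by
    change ‖(InnerProductSpace.toDual ℂ (Completion V)).symm (LinearMap.extendOfNorm (q y) e)‖ ≤ _
    rw [LinearIsometryEquiv.norm_map, hen]
    exact LinearMap.opNorm_extendOfNorm_le he (by positivity) (hq y)
  let D := LinearMap.extendOfNorm d' e
  have hD : ∀ y : V, D (e y) = d y := fun y => LinearMap.extendOfNorm_eq he ⟨c, hdn⟩ y
  have hDq : ∀ x y : V, ⟪e x, D (e y)⟫_ℂ = q x y := fun x y => by
    rw [hD, ← inner_conj_symm, hd, hsymm]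
  refine ⟨D, (ContinuousLinearMap.nonneg_iff_isPositive _).2 ?_, hDq⟩
  rw [ContinuousLinearMap.isPositive_def]
  constructor
  · intro u v
    induction u, v using Completion.induction_on₂ with
    | hp => exact isClosed_eq (by simp; fun_prop) (by simp; fun_prop)
    | ih x y =>
      change ⟪D (e x), e y⟫_ℂ = ⟪e x, D (e y)⟫_ℂ
      rw [hDq, ← inner_conj_symm, hDq, hsymm]
  · intro u
    induction u using Completion.induction_on with
    | hp => exact isClosed_le continuous_const (ContinuousLinearMap.reApplyInnerSelf_continuous D)
    | ih x =>
      rw [ContinuousLinearMap.reApplyInnerSelf_apply, inner_re_symm]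
      exact (hpos x).trans_eq (congrArg Complex.re (hDq x x)).symm

end Form

/-! ### Positive operator matrices -/

section CStarMatrix

open scoped ComplexOrder

variable {E : Type*} [NormedAddCommGroup E] [InnerProductSpace ℂ E] [CompleteSpace E] {k : ℕ}

/-- Positive elements are sums of elements `X* X`, and each contributes `∑ₗ ‖∑ⱼ X l j (ξ j)‖²`. -/
theorem cstarMatrix_sum_inner_nonneg {N : CStarMatrix (Fin k) (Fin k) (E →L[ℂ] E)} (hN : 0 ≤ N)
    (ξ : Fin k → E) : 0 ≤ ∑ i, ∑ j, ⟪ξ i, N i j (ξ j)⟫_ℂ := by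
  rw [StarOrderedRing.nonneg_iff] at hN
  induction hN using AddSubmonoid.closure_induction with
  | mem N hN =>
    obtain ⟨X, rfl⟩ := hN
    have h : ∀ i j, ⟪ξ i, (star X * X) i j (ξ j)⟫_ℂ = ∑ l, ⟪X l i (ξ i), X l j (ξ j)⟫_ℂ := by
      intro i j
      rw [CStarMatrix.mul_apply, sum_apply, inner_sum]
      refine Finset.sum_congr rfl fun l _ => ?_
      rw [CStarMatrix.star_apply, mul_apply_eq_comp, ContinuousLinearMap.star_eq_adjoint,
        ContinuousLinearMap.adjoint_inner_right]
    have h2 : ∑ i, ∑ j, ⟪ξ i, (star X * X) i j (ξ j)⟫_ℂ =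
        ∑ l, ⟪∑ i, X l i (ξ i), ∑ j, X l j (ξ j)⟫_ℂ := by
      simp_rw [h, sum_inner, inner_sum]
      rw [Finset.sum_comm (f := fun l i => ∑ j, ⟪X l i (ξ i), X l j (ξ j)⟫_ℂ)]
      exact Finset.sum_congr rfl fun i _ => Finset.sum_comm
    rw [h2]
    refine Finset.sum_nonneg fun l _ => ?_
    rw [inner_self_eq_norm_sq_to_K]
    positivity
  | zero => simp
  | add M N _ _ hM hN =>
    simp only [CStarMatrix.add_apply, add_apply, inner_add_right, Finset.sum_add_distrib]
    exact add_nonneg hM hN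

/-- The matrix is `X* X`, where `X` has the single nonzero row `|e⟩⟨a j|` for a unit vector `e`. The
cases without a row or without a unit vector are separate and trivial. -/
theorem cstarMatrix_rankOne_nonneg (a : Fin k → E) :
    (0 : CStarMatrix (Fin k) (Fin k) (E →L[ℂ] E)) ≤
      CStarMatrix.ofMatrix (Matrix.of fun i j => InnerProductSpace.rankOne ℂ (a i) (a j)) := by
  cases k with
  | zero => exact (congrArg (0 ≤ ·) (CStarMatrix.ext fun i => i.elim0)).mp le_rfl
  | succ k =>
    rcases subsingleton_or_nontrivial E with hE | hE
    · exact (congrArg (0 ≤ ·) (CStarMatrix.ext fun i j => Subsingleton.elim _ _)).mp le_rfl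
    · obtain ⟨e, he⟩ := exists_norm_eq E zero_le_one
      let X : CStarMatrix (Fin (k + 1)) (Fin (k + 1)) (E →L[ℂ] E) := CStarMatrix.ofMatrix
        (Matrix.of fun l j => if l = 0 then InnerProductSpace.rankOne ℂ e (a j) else 0)
      have hX : ∀ l j, X l j = if l = 0 then InnerProductSpace.rankOne ℂ e (a j) else 0 :=
        fun _ _ => rfl
      have h : star X * X =
          CStarMatrix.ofMatrix (Matrix.of fun i j => InnerProductSpace.rankOne ℂ (a i) (a j)) := by
        refine CStarMatrix.ext fun i j => ?_
        rw [CStarMatrix.mul_apply, Finset.sum_eq_single 0]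
        · rw [CStarMatrix.star_apply, hX, hX, if_pos rfl, if_pos rfl,
            ContinuousLinearMap.star_eq_adjoint, InnerProductSpace.adjoint_rankOne]
          change InnerProductSpace.rankOne ℂ (a i) e ∘L InnerProductSpace.rankOne ℂ e (a j) =
            InnerProductSpace.rankOne ℂ (a i) (a j)
          rw [InnerProductSpace.rankOne_comp_rankOne, inner_self_eq_norm_sq_to_K, he]
          simp
        · intro l _ hl
          rw [hX, if_neg hl, mul_zero]
        · simp
      rw [← h]
      exact star_mul_self_nonneg X

end CStarMatrix

section Tensor

variable {E F : Type*} [NormedAddCommGroup E] [InnerProductSpace ℂ E]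
  [NormedAddCommGroup F] [InnerProductSpace ℂ F]

theorem TensorProduct.exists_fin_sum (z : E ⊗[ℂ] F) :
    ∃ (k : ℕ) (ξ : Fin k → E) (η : Fin k → F), z = ∑ i, ξ i ⊗ₜ[ℂ] η i := by
  obtain ⟨S, rfl⟩ := TensorProduct.exists_finset z
  refine ⟨S.card, fun i => (S.equivFin.symm i).1.1, fun i => (S.equivFin.symm i).1.2, ?_⟩
  rw [← Finset.sum_coe_sort,
    ← S.equivFin.symm.sum_comp (fun p : S => p.1.1 ⊗ₜ[ℂ] p.1.2)]

end Tensor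

/-! ### Existence of the operational density -/

section OpDensity

open scoped ComplexOrder

variable {g h : Type*}
  [NormedAddCommGroup g] [InnerProductSpace ℂ g] [CompleteSpace g]
  [NormedAddCommGroup h] [InnerProductSpace ℂ h] [CompleteSpace h]
  (Jg : Conjugation g) (Jh : Conjugation h) (Φ : (h →L[ℂ] h) →CP (g →L[ℂ] g))

/-- The sesquilinear form of the operational density on the algebraic tensor product. -/
def densityForm : g ⊗[ℂ] h →ₗ⋆[ℂ] g ⊗[ℂ] h →ₗ[ℂ] ℂ :=
  TensorProduct.lift (LinearMap.mk₂'ₛₗ (starRingEnd ℂ) (starRingEnd ℂ)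
    (fun ξ η => TensorProduct.lift (LinearMap.mk₂' ℂ ℂ
      (fun ξ' η' => ⟪ξ, Φ (InnerProductSpace.rankOne ℂ (Jh η) (Jh η')) ξ'⟫_ℂ)
      (fun _ _ _ => by rw [map_add, inner_add_right])
      (fun _ _ _ => by rw [map_smul, inner_smul_right, smul_eq_mul])
      (fun _ _ _ => by rw [Jh.map_add, map_add, map_add, add_apply, inner_add_right])
      (fun _ _ _ => by
        rw [Jh.map_smul, map_smulₛₗ, starRingEnd_self_apply, map_smul, smul_apply,
          inner_smul_right, smul_eq_mul])))
    (fun _ _ _ => by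
      ext; simp)
    (fun _ _ _ => by
      ext; simp [mul_comm])
    (fun _ _ _ => by
      ext; simp [Jh.map_add])
    (fun _ _ _ => by
      ext; simp [Jh.map_smul]))

theorem densityForm_tmul (ξ ξ' : g) (η η' : h) : densityForm Jh Φ (ξ ⊗ₜ η) (ξ' ⊗ₜ η') =
    ⟪ξ, Φ (InnerProductSpace.rankOne ℂ (Jh η) (Jh η')) ξ'⟫_ℂ := rfl

theorem densityForm_sum {k : ℕ} (ξ : Fin k → g) (η : Fin k → h) :
    densityForm Jh Φ (∑ i, ξ i ⊗ₜ η i) (∑ i, ξ i ⊗ₜ η i) =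
      ∑ i, ∑ j, ⟪ξ i, Φ (InnerProductSpace.rankOne ℂ (Jh (η i)) (Jh (η j))) (ξ j)⟫_ℂ := by
  have h1 : ∀ z, densityForm Jh Φ (∑ i, ξ i ⊗ₜ η i) z =
      ∑ i, densityForm Jh Φ (ξ i ⊗ₜ η i) z := fun z => by rw [map_sum, LinearMap.sum_apply]
  rw [h1]
  refine Finset.sum_congr rfl fun i _ => ?_
  rw [map_sum]
  exact Finset.sum_congr rfl fun j _ => densityForm_tmul Jh Φ _ _ _ _

/-- Complete positivity, applied to the positive matrix `|J ηᵢ⟩⟨J ηⱼ|`. -/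
theorem densityForm_self_nonneg (z : g ⊗[ℂ] h) : 0 ≤ densityForm Jh Φ z z := by
  obtain ⟨k, ξ, η, rfl⟩ := TensorProduct.exists_fin_sum z
  have h0 := Φ.map_cstarMatrix_nonneg _ (cstarMatrix_rankOne_nonneg fun i => Jh (η i))
  have h1 := cstarMatrix_sum_inner_nonneg h0 ξ
  rw [densityForm_sum]
  refine h1.trans_eq ?_
  refine Finset.sum_congr rfl fun i _ => Finset.sum_congr rfl fun j _ => ?_
  rfl

/-- Complete majorization for the same matrix. The trace of `|J ηᵢ⟩⟨J ηⱼ|` is `⟨ηᵢ, ηⱼ⟩`, so the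
trace term sums to `c ‖z‖²`. -/
theorem densityForm_self_le (hΦ : IsCompletelyMajorized Φ) :
    ∃ c : ℝ, 0 ≤ c ∧ ∀ z, (densityForm Jh Φ z z).re ≤ c * ‖z‖ ^ 2 := by
  obtain ⟨c, hc, hM⟩ := hΦ
  refine ⟨c, hc.le, fun z => ?_⟩
  obtain ⟨k, ξ, η, rfl⟩ := TensorProduct.exists_fin_sum z
  have h1 := cstarMatrix_sum_inner_nonneg (hM k _ (cstarMatrix_rankOne_nonneg fun i => Jh (η i))
    fun i j => isTraceClass_rankOne _ _) ξ
  have h2 : ∑ i, ∑ j, ⟪ξ i, ((CStarMatrix.ofMatrix (Matrix.of fun i j =>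
        InnerProductSpace.rankOne ℂ (Jh (η i)) (Jh (η j)))).map
        (fun σ => ((c : ℂ) * opTrace σ) • (1 : g →L[ℂ] g) - Φ σ)) i j (ξ j)⟫_ℂ =
      (c : ℂ) * ⟪∑ i, ξ i ⊗ₜ[ℂ] η i, ∑ i, ξ i ⊗ₜ[ℂ] η i⟫_ℂ -
        densityForm Jh Φ (∑ i, ξ i ⊗ₜ[ℂ] η i) (∑ i, ξ i ⊗ₜ[ℂ] η i) := by
    rw [densityForm_sum, sum_inner, Finset.mul_sum, ← Finset.sum_sub_distrib]
    refine Finset.sum_congr rfl fun i _ => ?_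
    rw [inner_sum, Finset.mul_sum, ← Finset.sum_sub_distrib]
    refine Finset.sum_congr rfl fun j _ => ?_
    change ⟪ξ i, (((c : ℂ) * opTrace (InnerProductSpace.rankOne ℂ (Jh (η i)) (Jh (η j)))) •
      (1 : g →L[ℂ] g) - Φ (InnerProductSpace.rankOne ℂ (Jh (η i)) (Jh (η j)))) (ξ j)⟫_ℂ = _
    rw [sub_apply, smul_apply, one_apply_eq_self, inner_sub_right, inner_smul_right,
      opTrace_rankOne, Jh.inner_apply, TensorProduct.inner_tmul]
    ring
  have h4 : ⟪∑ i, ξ i ⊗ₜ[ℂ] η i, ∑ i, ξ i ⊗ₜ[ℂ] η i⟫_ℂ = (‖∑ i, ξ i ⊗ₜ[ℂ] η i‖ : ℂ) ^ 2 :=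
    inner_self_eq_norm_sq_to_K (𝕜 := ℂ) (E := g ⊗[ℂ] h) _
  rw [h2, h4] at h1
  have h3 := (Complex.nonneg_iff.1 h1).1
  rw [Complex.sub_re, sub_nonneg] at h3
  refine h3.trans_eq ?_
  rw [← Complex.ofReal_re (c * _)]
  push_cast
  rfl

theorem exists_density_inner (hΦ : IsCompletelyMajorized Φ) :
    ∃ D : HTensor g h →L[ℂ] HTensor g h, 0 ≤ D ∧ ∀ ξ ξ' η η',
      ⟪insertFst ξ η, D (insertFst ξ' η')⟫_ℂ =
        ⟪ξ, Φ (InnerProductSpace.rankOne ℂ (Jh η) (Jh η')) ξ'⟫_ℂ := by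
  obtain ⟨c, hc, h⟩ := densityForm_self_le Jh Φ hΦ
  obtain ⟨D, hD, hD'⟩ := exists_operator_of_form (densityForm Jh Φ) hc
    (fun z => (Complex.nonneg_iff.1 (densityForm_self_nonneg Jh Φ z)).2.symm)
    (fun z => (Complex.nonneg_iff.1 (densityForm_self_nonneg Jh Φ z)).1) h
  exact ⟨D, hD, fun ξ ξ' η η' => hD' _ _⟩

variable {Φ}

/-- Normality makes `B ↦ Tr(Φ(B) σ)` ultraweakly continuous, hence given by a trace class operator.
This is the predual map before transposes. -/
theorem exists_isPredual_transpose (hΦ : IsChannel Φ) {σ : g →L[ℂ] g} (hσ : IsTraceClass σ) :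
    ∃ τ : h →L[ℂ] h, IsTraceClass τ ∧ ∀ B, opTrace (Φ B ∘L σ) = opTrace (B ∘L τ) := by
  let φ : (h →L[ℂ] h) →ₗ[ℂ] ℂ :=
    { toFun := fun B => opTrace (Φ B ∘L σ)
      map_add' := fun A B => by
        rw [map_add, ContinuousLinearMap.add_comp,
          opTrace_add (hσ.comp_left _) (hσ.comp_left _)]
      map_smul' := fun c B => by
        rw [map_smul, ContinuousLinearMap.smul_comp, opTrace_smul]; rfl }
  refine exists_isTraceClass_of_continuous φ ?_
  have h1 : @Continuous _ _ (ultraweak g) _ fun B : g →L[ℂ] g => opTrace (B ∘L σ) :=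
    continuous_iInf_dom (i := (⟨σ, hσ⟩ : {σ : g →L[ℂ] g // IsTraceClass σ})) continuous_induced_dom
  exact @Continuous.comp _ _ _ (ultraweak h) (ultraweak g) _ _ _ h1 hΦ.normal

/-- The form fixes `D` only through `Φ` on rank-one operators. By normality, the block of `D` at `ξ,
ξ'` is the transpose of the trace class operator representing `B ↦ ⟨ξ, Φ(B) ξ'⟩`, so the density
formula holds for all `B`. -/
theorem exists_isOpDensity (hΦ : IsChannel Φ) (hΦτ : IsCompletelyMajorized Φ) :
    ∃ D, IsOpDensity Jh Φ D := by
  obtain ⟨D, hD, hD'⟩ := exists_density_inner Jh Φ hΦτ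
  refine ⟨D, hD, fun B ξ ξ' => ?_⟩
  obtain ⟨τ, hτ, hτ'⟩ := exists_isPredual_transpose hΦ (isTraceClass_rankOne ξ' ξ)
  simp_rw [opTrace_comp_rankOne] at hτ'
  have h1 : (insertFst ξ : h →L[ℂ] HTensor g h)† ∘L (tensorOp 1 (transpose Jh B) ∘L D) ∘L
      insertFst ξ' = transpose Jh B ∘L transpose Jh τ := by
    have h2 : (insertFst ξ : h →L[ℂ] HTensor g h)† ∘L D ∘L insertFst ξ' = transpose Jh τ :=
      ContinuousLinearMap.ext fun η' => ext_inner_left ℂ fun η => by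
        rw [ContinuousLinearMap.comp_apply, ContinuousLinearMap.adjoint_inner_right,
          ContinuousLinearMap.comp_apply, hD', hτ', hτ.opTrace_comm, opTrace_comp_rankOne,
          inner_transpose_apply]
    rw [← h2, ← ContinuousLinearMap.comp_assoc, ← ContinuousLinearMap.comp_assoc,
      adjoint_insertFst_comp_tensorOp, ContinuousLinearMap.adjoint_one]
    rfl
  rw [h1, ← transpose_comp]
  refine ⟨(hτ.comp_right B).transpose Jh, ?_⟩
  rw [opTrace_transpose Jh (hτ.comp_right B), ← hτ.opTrace_comm, hτ']

theorem isOpDensity_opDensity (hΦ : IsChannel Φ) (hΦτ : IsCompletelyMajorized Φ) :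
    IsOpDensity Jh Φ (opDensity Jh Φ) := by
  have h := exists_isOpDensity Jh hΦ hΦτ
  rw [opDensity, dif_pos h]
  exact h.choose_spec

end OpDensity

/-! ### Slices and partial traces -/

section Parseval

variable {E F : Type*} [NormedAddCommGroup E] [InnerProductSpace ℂ E] [CompleteSpace E]
  [NormedAddCommGroup F] [InnerProductSpace ℂ F] [CompleteSpace F] {ι κ : Type*}

theorem hasSum_norm_sq_of_tsum_enorm {V W : Type*} [NormedAddCommGroup V] [NormedAddCommGroup W]
    {y : ι → V} {x : W} (h : ∑' i, ‖y i‖ₑ ^ 2 = ‖x‖ₑ ^ 2) :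
    HasSum (fun i => ‖y i‖ ^ 2) (‖x‖ ^ 2) := by
  simp_rw [enorm_sq_eq_ofReal] at h
  have hs : Summable fun i => ‖y i‖ ^ 2 :=
    (ENNReal.summable_toReal (h.trans_ne ENNReal.ofReal_ne_top)).congr fun i =>
      ENNReal.toReal_ofReal (by positivity)
  rw [← ENNReal.ofReal_tsum_of_nonneg (fun _ => by positivity) hs] at h
  rw [← (ENNReal.ofReal_eq_ofReal_iff (tsum_nonneg fun _ => by positivity) (by positivity)).1 h]
  exact hs.hasSum

theorem hilbertBasis_ext (e : HilbertBasis ι ℂ E) {x y : E} (h : ∀ i, ⟪e i, x⟫_ℂ = ⟪e i, y⟫_ℂ) :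
    x = y := by
  refine e.repr.injective (lp.ext (funext fun i => ?_))
  rw [e.repr_apply_apply, e.repr_apply_apply, h]

theorem hasSum_inner_adjoint_insertSnd (f : HilbertBasis κ ℂ F) (x y : HTensor E F) :
    HasSum (fun k => ⟪((insertSnd (f k) : E →L[ℂ] HTensor E F)†) x,
      ((insertSnd (f k) : E →L[ℂ] HTensor E F)†) y⟫_ℂ) ⟪x, y⟫_ℂ := by
  simp_rw [fun k => ContinuousLinearMap.adjoint_inner_left
    (insertSnd (f k) : E →L[ℂ] HTensor E F) (((insertSnd (f k) : E →L[ℂ] HTensor E F)†) y) x]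
  exact (innerSL ℂ x).hasSum (HTensor.hasSum_insertSnd f y)

theorem adjoint_insertFst_eq (ξ : E) (x : HTensor E F) :
    ((insertFst ξ : F →L[ℂ] HTensor E F)†) x =
      ((insertSnd ξ : F →L[ℂ] HTensor F E)†) (tensorSwap F E x) :=
  ext_inner_left ℂ fun η => by
    rw [ContinuousLinearMap.adjoint_inner_right, ContinuousLinearMap.adjoint_inner_right,
      insertSnd_apply, ← adjoint_tensorSwap, ContinuousLinearMap.adjoint_inner_right,
      tensorSwap_insertFst]

theorem hasSum_inner_adjoint_insertFst (e : HilbertBasis ι ℂ E) (x y : HTensor E F) :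
    HasSum (fun k => ⟪((insertFst (e k) : F →L[ℂ] HTensor E F)†) x,
      ((insertFst (e k) : F →L[ℂ] HTensor E F)†) y⟫_ℂ) ⟪x, y⟫_ℂ := by
  simp_rw [adjoint_insertFst_eq]
  have h := hasSum_inner_adjoint_insertSnd e (tensorSwap F E x) (tensorSwap F E y)
  rwa [← ContinuousLinearMap.adjoint_inner_right, adjoint_tensorSwap,
    ← ContinuousLinearMap.comp_apply, tensorSwap_comp_tensorSwap] at h

/-- The trace of `Y` in a product basis is absolutely convergent and is summed fibrewise. No trace
class assumption on `T` enters. -/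
theorem IsPartialTraceFst.hasSum {Y : HTensor E F →L[ℂ] HTensor E F} {T : F →L[ℂ] F}
    (hT : IsPartialTraceFst Y T) (hY : IsTraceClass Y) (f : HilbertBasis κ ℂ F) :
    HasSum (fun k => ⟪f k, T (f k)⟫_ℂ) (opTrace Y) := by
  have h := hY.hasSum (tensorBasis (stdBasis E) f)
  rw [← (Equiv.prodComm _ _).hasSum_iff] at h
  refine h.prod_fiberwise fun k => ?_
  rw [(hT _ _).2]
  convert (hT (f k) (f k)).1.hasSum (stdBasis E) using 2 with i
  rw [ContinuousLinearMap.comp_apply, ContinuousLinearMap.adjoint_inner_right]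
  simp only [Function.comp_apply, tensorBasis_apply]
  rfl

theorem IsPartialTraceFst.unique {Y : HTensor E F →L[ℂ] HTensor E F} {S T : F →L[ℂ] F}
    (hS : IsPartialTraceFst Y S) (hT : IsPartialTraceFst Y T) : S = T :=
  ContinuousLinearMap.ext fun y => ext_inner_left ℂ fun x => by rw [(hS _ _).2, (hT _ _).2]

theorem IsPartialTraceFst.partialTraceFst_eq {Y : HTensor E F →L[ℂ] HTensor E F} {T : F →L[ℂ] F}
    (hT : IsPartialTraceFst Y T) : partialTraceFst Y = T := by
  have h : ∃ T, IsPartialTraceFst Y T := ⟨T, hT⟩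
  rw [partialTraceFst, dif_pos h]
  exact h.choose_spec.unique hT

end Parseval

/-! ### Realignment of Stinespring operators into roots of the density -/

section Realignment

variable {g h k : Type*}
  [NormedAddCommGroup g] [InnerProductSpace ℂ g] [CompleteSpace g]
  [NormedAddCommGroup h] [InnerProductSpace ℂ h] [CompleteSpace h]
  [NormedAddCommGroup k] [InnerProductSpace ℂ k] [CompleteSpace k]
  {G : Type*} [NormedAddCommGroup G] [InnerProductSpace ℂ G] [CompleteSpace G]
  {ι κ : Type*}
  {Jh : Conjugation h} {Φ : (h →L[ℂ] h) →CP (g →L[ℂ] g)}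
  {D : HTensor g h →L[ℂ] HTensor g h}

theorem adjoint_insertFst_comp_tensorOp_one (A : h →L[ℂ] h) (ξ : g) :
    (insertFst ξ : h →L[ℂ] HTensor g h)† ∘L tensorOp 1 A =
      A ∘L (insertFst ξ : h →L[ℂ] HTensor g h)† := by
  rw [adjoint_insertFst_comp_tensorOp, ContinuousLinearMap.adjoint_one]
  rfl

theorem IsOpDensity.opTrace_eq (hD : IsOpDensity Jh Φ D) (B : h →L[ℂ] h) (ξ ξ' : g) :
    ⟪ξ, Φ B ξ'⟫_ℂ = opTrace (transpose Jh B ∘L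
      ((insertFst ξ : h →L[ℂ] HTensor g h)† ∘L D ∘L insertFst ξ')) := by
  rw [(hD.2 B ξ ξ').2, ContinuousLinearMap.comp_assoc, ← ContinuousLinearMap.comp_assoc _ (tensorOp _ _),
    adjoint_insertFst_comp_tensorOp_one, ContinuousLinearMap.comp_assoc]

theorem IsOpDensity.isTraceClass (hD : IsOpDensity Jh Φ D) (ξ ξ' : g) :
    IsTraceClass ((insertFst ξ : h →L[ℂ] HTensor g h)† ∘L D ∘L insertFst ξ') := by
  have h1 := (hD.2 1 ξ ξ').1
  rw [transpose_one, tensorOp_one_one] at h1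
  exact h1

theorem IsOpDensity.inner_eq (hD : IsOpDensity Jh Φ D) (ξ ξ' : g) (η η' : h) :
    ⟪insertFst ξ η, D (insertFst ξ' η')⟫_ℂ =
      ⟪ξ, Φ (InnerProductSpace.rankOne ℂ (Jh η) (Jh η')) ξ'⟫_ℂ := by
  rw [hD.opTrace_eq, transpose_rankOne, Jh.apply_apply, Jh.apply_apply,
    (hD.isTraceClass ξ ξ').opTrace_comm, opTrace_comp_rankOne, ContinuousLinearMap.comp_apply,
    ContinuousLinearMap.adjoint_inner_right]
  rfl

variable {Γ Υ : HTensor g h →L[ℂ] k}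

theorem adjoint_comp_insertFst (hΓ : Γ† ∘L Γ = D) (ξ ξ' : g) :
    (Γ ∘L insertFst ξ)† ∘L (Γ ∘L insertFst ξ') =
      (insertFst ξ : h →L[ℂ] HTensor g h)† ∘L D ∘L insertFst ξ' := by
  rw [← hΓ, ContinuousLinearMap.adjoint_comp]
  rfl

/-- The squared Hilbert–Schmidt norm is the trace of the diagonal block of `D` at `ξ`, which is `⟨ξ,
Φ(1) ξ⟩`. -/
theorem hsNormSq_comp_insertFst (hD : IsOpDensity Jh Φ D) (hu : Φ 1 = 1) (hΓ : Γ† ∘L Γ = D)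
    (ξ : g) : hsNormSq (Γ ∘L insertFst ξ) = ‖ξ‖ₑ ^ 2 := by
  have h1 := hD.opTrace_eq 1 ξ ξ
  have h2 := hD.isTraceClass ξ ξ
  rw [← adjoint_comp_insertFst hΓ] at h1 h2
  have h3 : IsHS (Γ ∘L insertFst ξ) := by
    rw [IsHS, ← traceNorm_adjoint_comp_self]; exact h2
  have h4 : opTrace (transpose Jh 1 ∘L ((Γ ∘L insertFst ξ)† ∘L (Γ ∘L insertFst ξ))) =
      ((hsNormSq (Γ ∘L insertFst ξ)).toReal : ℂ) := by
    rw [transpose_one, ← h3.opTrace_adjoint_comp_self]; rfl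
  rw [h4, hu, one_apply_eq_self, inner_self_eq_norm_sq_to_K] at h1
  have h5 : (hsNormSq (Γ ∘L insertFst ξ)).toReal = ‖ξ‖ ^ 2 :=
    Complex.ofReal_injective (h1.symm.trans (Complex.ofReal_pow _ _).symm)
  rw [← ENNReal.ofReal_toReal h3, h5, enorm_sq_eq_ofReal]

/-- Although `N ⊗ 1` is not Hilbert–Schmidt when `h` is infinite-dimensional and `N ≠ 0`, composing
with a root of the density makes it so. Taking `N = ρ^{1/2}` makes `Υ (ρ ⊗ 1) Γ†` trace class. -/
theorem hsNormSq_comp_tensorOp (hD : IsOpDensity Jh Φ D) (hu : Φ 1 = 1) (hΓ : Γ† ∘L Γ = D)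
    (N : G →L[ℂ] g) : hsNormSq (Γ ∘L tensorOp N (1 : h →L[ℂ] h)) = hsNormSq N := by
  rw [hsNormSq_eq (tensorBasis (stdBasis G) (stdBasis h)),
    ENNReal.tsum_prod' , hsNormSq]
  refine tsum_congr fun i => ?_
  rw [← hsNormSq_comp_insertFst hD hu hΓ, hsNormSq]
  refine tsum_congr fun j => ?_
  rw [tensorBasis_apply, ContinuousLinearMap.comp_apply, tensorOp_insertFst]
  rfl

theorem comp_tensorOp_comp_adjoint (N : G →L[ℂ] g) :
    Υ ∘L tensorOp (N ∘L N†) 1 ∘L Γ† = 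
      (Υ ∘L tensorOp N (1 : h →L[ℂ] h)) ∘L (Γ ∘L tensorOp N (1 : h →L[ℂ] h))† := by
  have h1 : (tensorOp (N ∘L N†) 1 : HTensor g h →L[ℂ] HTensor g h) =
      tensorOp N (1 : h →L[ℂ] h) ∘L (tensorOp N (1 : h →L[ℂ] h))† := by
    rw [tensorOp_adjoint, tensorOp_comp, ContinuousLinearMap.adjoint_one]; rfl
  rw [ContinuousLinearMap.adjoint_comp, h1]
  rfl

/-- `F : g → h ⊗ k` and `Γ : g ⊗ h → k` are realignments of each other:
`⟨η ⊗ c, F ξ⟩ = ⟨c, Γ (ξ ⊗ J η)⟩`. -/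
def IsRealignment (Jh : Conjugation h) (F : g →L[ℂ] HTensor h k) (Γ : HTensor g h →L[ℂ] k) : Prop :=
  ∀ ξ η, Γ (insertFst ξ η) = ((insertFst (Jh η) : k →L[ℂ] HTensor h k)†) (F ξ)

variable {F V : g →L[ℂ] HTensor h k}

theorem IsRealignment.adjoint_insertSnd (hF : IsRealignment Jh F Γ) (ξ : g) (c : k) :
    ((insertSnd c : h →L[ℂ] HTensor h k)†) (F ξ) =
      Jh (((insertFst ξ : h →L[ℂ] HTensor g h)†) ((Γ†) c)) :=
  ext_inner_left ℂ fun η => by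
    rw [ContinuousLinearMap.adjoint_inner_right, insertSnd_apply, Jh.inner_apply_right,
      ContinuousLinearMap.adjoint_inner_left, ContinuousLinearMap.adjoint_inner_left, hF,
      Jh.apply_apply, ContinuousLinearMap.adjoint_inner_right]

/-- Slicing `F†(B ⊗ 1)F` along a basis of `k` turns it into a trace over `k`. Cyclicity moves this
to the trace over `h` that defines the density. -/
theorem IsRealignment.isStinespring (hF : IsRealignment Jh F Γ) (hD : IsOpDensity Jh Φ D)
    (hu : Φ 1 = 1) (hΓ : Γ† ∘L Γ = D) : IsStinespring Φ F := by
  have hHS : ∀ ξ, IsHS (Γ ∘L insertFst ξ) := fun ξ => by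
    rw [IsHS, hsNormSq_comp_insertFst hD hu hΓ]; finiteness
  refine fun B => ContinuousLinearMap.ext fun ξ' => ext_inner_left ℂ fun ξ => ?_
  rw [ContinuousLinearMap.comp_apply, ContinuousLinearMap.adjoint_inner_right,
    ContinuousLinearMap.comp_apply, ← (hasSum_inner_adjoint_insertSnd (stdBasis k) _ _).tsum_eq,
    hD.opTrace_eq, ← adjoint_comp_insertFst hΓ, ← ContinuousLinearMap.comp_assoc,
    opTrace_comp_comm (hHS ξ') ((hHS ξ).adjoint.comp_left _), opTrace]
  refine tsum_congr fun j => ?_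
  have h1 : ((insertSnd (stdBasis k j) : h →L[ℂ] HTensor h k)†) (tensorOp B 1 (F ξ')) =
      B (((insertSnd (stdBasis k j) : h →L[ℂ] HTensor h k)†) (F ξ')) := by
    rw [← ContinuousLinearMap.comp_apply, adjoint_insertSnd_comp_tensorOp,
      ContinuousLinearMap.adjoint_one]
    rfl
  rw [h1, hF.adjoint_insertSnd, hF.adjoint_insertSnd, ← inner_transpose_apply]
  rw [ContinuousLinearMap.adjoint_inner_left, ← ContinuousLinearMap.adjoint_inner_right]
  simp only [ContinuousLinearMap.comp_apply, ContinuousLinearMap.adjoint_comp,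
    ContinuousLinearMap.adjoint_adjoint]

/-- The Stinespring identity at `B = |J η⟩⟨J η'|` says that the realigned map `γ` on the algebraic
tensor product satisfies `⟨γ z, γ w⟩ = ⟨z, D w⟩`. This gives both boundedness and `Γ†Γ = D`. -/
theorem IsStinespring.exists_realignment (hF : IsStinespring Φ F) (hD : IsOpDensity Jh Φ D) :
    ∃ Γ : HTensor g h →L[ℂ] k, Γ† ∘L Γ = D ∧ IsRealignment Jh F Γ := by
  let γ : g ⊗[ℂ] h →ₗ[ℂ] k := TensorProduct.lift (LinearMap.mk₂' ℂ ℂ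
    (fun ξ η => ((insertFst (Jh η) : k →L[ℂ] HTensor h k)†) (F ξ))
    (fun _ _ _ => by rw [map_add, map_add])
    (fun _ _ _ => by rw [map_smul, map_smul])
    (fun _ _ _ => by rw [Jh.map_add, insertFst_add, map_add, add_apply])
    (fun _ _ _ => by
      rw [Jh.map_smul, insertFst_smul, map_smulₛₗ, starRingEnd_self_apply, smul_apply]))
  let e : g ⊗[ℂ] h →ₗ[ℂ] HTensor g h :=
    (UniformSpace.Completion.toComplL : g ⊗[ℂ] h →L[ℂ] HTensor g h).toLinearMap
  have he : DenseRange e := UniformSpace.Completion.denseRange_coe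
  have hγ : ∀ z w, ⟪γ z, γ w⟫_ℂ = ⟪e z, D (e w)⟫_ℂ := by
    intro z w
    induction z using TensorProduct.induction_on with
    | zero => simp
    | add x y hx hy => rw [map_add, map_add, inner_add_left, inner_add_left, hx, hy]
    | tmul ξ η =>
      induction w using TensorProduct.induction_on with
      | zero => simp
      | add x y hx hy => rw [map_add, map_add, map_add, inner_add_right, inner_add_right, hx, hy]
      | tmul ξ' η' =>
        change ⟪((insertFst (Jh η) : k →L[ℂ] HTensor h k)†) (F ξ),
          ((insertFst (Jh η') : k →L[ℂ] HTensor h k)†) (F ξ')⟫_ℂ =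
            ⟪insertFst ξ η, D (insertFst ξ' η')⟫_ℂ
        rw [hD.inner_eq, hF, ← insertFst_comp_adjoint_insertFst,
          ContinuousLinearMap.adjoint_inner_left, ContinuousLinearMap.comp_apply,
          ContinuousLinearMap.adjoint_inner_right]
        rfl
  have hb : ∀ z, ‖γ z‖ ≤ √‖D‖ * ‖e z‖ := fun z => by
    refine le_of_sq_le_sq ?_ (by positivity)
    rw [mul_pow, Real.sq_sqrt (norm_nonneg D)]
    have h1 : ‖γ z‖ ^ 2 = ‖⟪e z, D (e z)⟫_ℂ‖ := by
      rw [← hγ, inner_self_eq_norm_sq_to_K]; simp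
    rw [h1]
    refine (norm_inner_le_norm _ _).trans ?_
    have := D.le_opNorm (e z)
    nlinarith [norm_nonneg (e z)]
  have hΓ : ∀ z, LinearMap.extendOfNorm γ e (e z) = γ z :=
    fun z => LinearMap.extendOfNorm_eq he ⟨_, hb⟩ z
  refine ⟨LinearMap.extendOfNorm γ e, ?_, fun ξ η => hΓ (ξ ⊗ₜ η)⟩
  refine HTensor.clm_ext fun ξ' η' => HTensor.ext_inner fun ξ η => ?_
  rw [ContinuousLinearMap.comp_apply, ContinuousLinearMap.adjoint_inner_right]
  exact (congrArg₂ _ (hΓ (ξ ⊗ₜ η)) (hΓ (ξ' ⊗ₜ η'))).trans (hγ _ _)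

theorem exists_isStinespring (hD : IsOpDensity Jh Φ D) (hu : Φ 1 = 1) (hΓ : Γ† ∘L Γ = D) :
    ∃ F : g →L[ℂ] HTensor h k, IsStinespring Φ F ∧ IsRealignment Jh F Γ := by
  let A : ∀ j, g →L[ℂ] h := fun j => LinearMap.mkContinuous
    { toFun := fun ξ => Jh (((insertFst ξ : h →L[ℂ] HTensor g h)†) ((Γ†) (stdBasis k j)))
      map_add' := fun _ _ => by rw [insertFst_add, map_add, add_apply, Jh.map_add]
      map_smul' := fun _ _ => by
        rw [insertFst_smul, map_smulₛₗ, smul_apply, Jh.map_smul, starRingEnd_self_apply,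
          RingHom.id_apply] } ‖(Γ†) (stdBasis k j)‖ fun ξ => by
    change ‖Jh (((insertFst ξ : h →L[ℂ] HTensor g h)†) ((Γ†) (stdBasis k j)))‖ ≤ _
    rw [Jh.norm_apply, mul_comm]
    refine ContinuousLinearMap.le_of_opNorm_le _ ?_ _
    rw [LinearIsometryEquiv.norm_map]
    refine ContinuousLinearMap.opNorm_le_bound _ (norm_nonneg _) fun η => ?_
    rw [← insertSnd_apply, norm_insertSnd]
  have hA : ∀ j ξ, A j ξ = Jh (((insertFst ξ : h →L[ℂ] HTensor g h)†) ((Γ†) (stdBasis k j))) :=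
    fun _ _ => rfl
  -- The sum is the squared Hilbert–Schmidt norm of `(Γ ∘L insertFst ξ)†`; unitality makes it
  -- `‖ξ‖²`, so the slices assemble into an operator.
  have hs : ∀ ξ, HasSum (fun j => ‖A j ξ‖ ^ 2) (‖ξ‖ ^ 2) := fun ξ => by
    simp_rw [hA, Jh.norm_apply]
    refine hasSum_norm_sq_of_tsum_enorm ?_
    rw [← hsNormSq_comp_insertFst hD hu hΓ, ← hsNormSq_adjoint, ContinuousLinearMap.adjoint_comp]
    rfl
  obtain ⟨F, hF⟩ := exists_adjoint_insertSnd_comp_eq (stdBasis k) A hs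
  have hR : IsRealignment Jh F Γ := fun ξ η => hilbertBasis_ext (stdBasis k) fun j => by
    have h1 : ((insertSnd (stdBasis k j) : h →L[ℂ] HTensor h k)†) (F ξ) = A j ξ :=
      congrArg (fun T : g →L[ℂ] h => T ξ) (hF j)
    rw [ContinuousLinearMap.adjoint_inner_right, ← insertSnd_apply (Jh η) (stdBasis k j),
      ← ContinuousLinearMap.adjoint_inner_right, h1, hA,
      Jh.inner_apply, ContinuousLinearMap.adjoint_inner_left,
      ContinuousLinearMap.adjoint_inner_left]
  exact ⟨F, hR.isStinespring hD hu hΓ, hR⟩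

/-- The matrix elements at `c, c'` of both sides expand over a basis of `G` into inner products of
slices. Realignment conjugates each slice by `J`, which reverses the order in the inner product and
so matches the two sums. -/
theorem isPartialTraceFst_of_realignment (hF : IsRealignment Jh F Γ) (hV : IsRealignment Jh V Υ)
    {N : G →L[ℂ] g} (hN : IsHS N) :
    IsPartialTraceFst (F ∘L (N ∘L N†) ∘L V†) (Γ ∘L tensorOp (N ∘L N†) 1 ∘L Υ†) := by
  intro c c'
  set Fc : g →L[ℂ] h := (insertSnd c : h →L[ℂ] HTensor h k)† ∘L F with hFc
  set Vc : g →L[ℂ] h := (insertSnd c' : h →L[ℂ] HTensor h k)† ∘L V with hVc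
  have h1 : (insertSnd c : h →L[ℂ] HTensor h k)† ∘L (F ∘L (N ∘L N†) ∘L V†) ∘L insertSnd c' =
      (Fc ∘L N) ∘L (Vc ∘L N)† := by
    rw [hFc, hVc, ContinuousLinearMap.adjoint_comp, ContinuousLinearMap.adjoint_comp,
      ContinuousLinearMap.adjoint_adjoint]
    rfl
  have hA := hN.comp_left Fc
  have hB := hN.comp_left Vc
  rw [h1]
  refine ⟨isTraceClass_comp hB.adjoint hA, ?_⟩
  rw [← opTrace_adjoint_comp_comm hB hA, opTrace_adjoint_comp hB hA (stdBasis G),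
    comp_tensorOp_comp_adjoint, ContinuousLinearMap.comp_apply,
    ← ContinuousLinearMap.adjoint_inner_left,
    ← (hasSum_inner_adjoint_insertFst (stdBasis G) _ _).tsum_eq]
  refine tsum_congr fun i => ?_
  have h2 : ∀ (F : g →L[ℂ] HTensor h k) (Γ : HTensor g h →L[ℂ] k) (_ : IsRealignment Jh F Γ) (c : k),
      (((insertSnd c : h →L[ℂ] HTensor h k)† ∘L F) ∘L N) (stdBasis G i) =
      Jh (((insertFst (stdBasis G i) : h →L[ℂ] HTensor G h)†) (((Γ ∘L tensorOp N (1 : h →L[ℂ] h))†) c)) := by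
    intro F Γ hF c
    rw [ContinuousLinearMap.comp_apply, ContinuousLinearMap.comp_apply, hF.adjoint_insertSnd]
    congr 1
    rw [ContinuousLinearMap.adjoint_comp, tensorOp_adjoint, ContinuousLinearMap.comp_apply,
      ← ContinuousLinearMap.comp_apply _ (tensorOp (N†) (1†)), adjoint_insertFst_comp_tensorOp,
      ContinuousLinearMap.adjoint_adjoint, ContinuousLinearMap.adjoint_one,
      ContinuousLinearMap.comp_apply]
    rfl
  rw [hFc, hVc, h2 F Γ hF, h2 V Υ hV, Jh.inner_apply]

end Realignment

/-! ### Trace norm bounds in the extended reals -/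

section Extended

variable {E : Type*} [NormedAddCommGroup E] [InnerProductSpace ℂ E] [CompleteSpace E]

theorem IsTraceClass.coe_toReal_traceNorm {T : E →L[ℂ] E} (hT : IsTraceClass T) :
    (((traceNorm T).toReal : ℝ) : EReal) = (traceNorm T : EReal) := by
  lift traceNorm T to NNReal using hT with r
  rfl

theorem coe_norm_opTrace_le {T : E →L[ℂ] E} (hT : IsTraceClass T) :
    ((‖opTrace T‖ : ℝ) : EReal) ≤ (traceNorm T : EReal) := by
  rw [← hT.coe_toReal_traceNorm, EReal.coe_le_coe_iff, ← toReal_enorm]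
  exact ENNReal.toReal_mono hT (enorm_opTrace_le T)

theorem coe_traceNorm_le_of_forall_isometry {T : E →L[ℂ] E} (hT : IsTraceClass T) {s : EReal}
    (hs : ∀ W : E →L[ℂ] E, W† ∘L W = 1 → (((opTrace (W ∘L T)).re : ℝ) : EReal) ≤ s) :
    (traceNorm T : EReal) ≤ s := by
  rw [← hT.coe_toReal_traceNorm]
  by_contra! h
  obtain ⟨m, hm, hm'⟩ := EReal.lt_iff_exists_real_btwn.1 h
  exact hm'.not_ge (EReal.coe_le_coe_iff.2 (traceNorm_le_of_forall_isometry hT fun W hW =>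
    EReal.coe_le_coe_iff.1 ((hs W hW).trans hm.le)))

theorem IsDensity.sqrt_comp_adjoint {ρ : E →L[ℂ] E} (hρ : IsDensity ρ) :
    CFC.sqrt ρ ∘L (CFC.sqrt ρ)† = ρ := by
  conv_rhs => rw [← sqrt_adjoint_comp_sqrt hρ.nonneg]
  rw [sqrt_adjoint]

theorem IsDensity.isHS_sqrt {ρ : E →L[ℂ] E} (hρ : IsDensity ρ) : IsHS (CFC.sqrt ρ) := by
  rw [IsHS, hρ.hsNormSq_sqrt]
  exact ENNReal.one_ne_top

theorem isometry_comp_sqrt {D W : E →L[ℂ] E} (hD : 0 ≤ D) (hW : W† ∘L W = 1) :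
    (W ∘L CFC.sqrt D)† ∘L (W ∘L CFC.sqrt D) = D := by
  rw [ContinuousLinearMap.adjoint_comp, ContinuousLinearMap.comp_assoc,
    ← ContinuousLinearMap.comp_assoc _ W, hW]
  exact sqrt_adjoint_comp_sqrt hD

end Extended

/-! ### Kraus families as slices of Stinespring operators -/

section Kraus

variable {g h k : Type*}
  [NormedAddCommGroup g] [InnerProductSpace ℂ g] [CompleteSpace g]
  [NormedAddCommGroup h] [InnerProductSpace ℂ h] [CompleteSpace h]
  [NormedAddCommGroup k] [InnerProductSpace ℂ k] [CompleteSpace k]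
  {ι : Type*} {Φ : (h →L[ℂ] h) →CP (g →L[ℂ] g)}

theorem adjoint_insertSnd_comp_tensorOp_one (B : h →L[ℂ] h) (c : k) :
    (insertSnd c : h →L[ℂ] HTensor h k)† ∘L tensorOp B 1 =
      B ∘L (insertSnd c : h →L[ℂ] HTensor h k)† := by
  rw [adjoint_insertSnd_comp_tensorOp, ContinuousLinearMap.adjoint_one]
  rfl

theorem IsStinespring.isKraus {F : g →L[ℂ] HTensor h k} (hF : IsStinespring Φ F)
    (b : HilbertBasis ι ℂ k) :
    IsKraus Φ fun j => (insertSnd (b j) : h →L[ℂ] HTensor h k)† ∘L F := by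
  intro B ξ
  rw [hF B]
  have h1 := (F†).hasSum (HTensor.hasSum_insertSnd b (tensorOp B 1 (F ξ)))
  refine h1.congr_fun fun j => ?_
  rw [ContinuousLinearMap.adjoint_comp, ContinuousLinearMap.adjoint_adjoint,
    ← ContinuousLinearMap.comp_apply _ (tensorOp B 1), adjoint_insertSnd_comp_tensorOp_one]
  rfl

/-- The Kraus identity at `B = 1` gives `∑ ‖F j ξ‖² = ‖ξ‖²`, so the family is the family of slices
of one operator. -/
theorem IsKraus.exists_isStinespring {F : ι → g →L[ℂ] h} (hF : IsKraus Φ F) (hu : Φ 1 = 1)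
    (b : HilbertBasis ι ℂ k) :
    ∃ T : g →L[ℂ] HTensor h k, IsStinespring Φ T ∧
      ∀ j, (insertSnd (b j) : h →L[ℂ] HTensor h k)† ∘L T = F j := by
  have hw : ∀ B ξ ξ', HasSum (fun j => ⟪F j ξ, B (F j ξ')⟫_ℂ) ⟪ξ, Φ B ξ'⟫_ℂ := fun B ξ ξ' => by
    refine ((innerSL ℂ ξ).hasSum (hF B ξ')).congr_fun fun j => ?_
    rw [innerSL_apply_apply, ContinuousLinearMap.comp_apply,
      ContinuousLinearMap.adjoint_inner_right]
    rfl
  obtain ⟨T, hT⟩ := exists_adjoint_insertSnd_comp_eq b F fun ξ => by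
    have h1 := Complex.hasSum_re (hw 1 ξ ξ)
    rw [hu, one_apply_eq_self] at h1
    convert h1 using 1
    · funext j
      exact (inner_self_eq_norm_sq (𝕜 := ℂ) _).symm
    · exact (inner_self_eq_norm_sq (𝕜 := ℂ) _).symm
  refine ⟨T, fun B => ContinuousLinearMap.ext fun ξ' => ext_inner_left ℂ fun ξ => ?_, hT⟩
  have hT' : ∀ j ξ, ((insertSnd (b j) : h →L[ℂ] HTensor h k)†) (T ξ) = F j ξ := fun j ξ =>
    congrArg (fun S : g →L[ℂ] h => S ξ) (hT j)
  rw [ContinuousLinearMap.comp_apply, ContinuousLinearMap.adjoint_inner_right]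
  refine (hw B ξ ξ').unique ((hasSum_inner_adjoint_insertSnd b _ _).congr_fun fun j => ?_)
  rw [ContinuousLinearMap.comp_apply, ← ContinuousLinearMap.comp_apply _ (tensorOp B 1),
    adjoint_insertSnd_comp_tensorOp_one, ContinuousLinearMap.comp_apply, hT', hT']

end Kraus

/-! ### The overlap, common value of the suprema at a fixed density -/

section Overlap

variable {g h k : Type*}
  [NormedAddCommGroup g] [InnerProductSpace ℂ g] [CompleteSpace g]
  [NormedAddCommGroup h] [InnerProductSpace ℂ h] [CompleteSpace h]
  [NormedAddCommGroup k] [InnerProductSpace ℂ k] [CompleteSpace k]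
  {ι : Type*} {Jg : Conjugation g} {Jh : Conjugation h} {Φ Ψ : (h →L[ℂ] h) →CP (g →L[ℂ] g)}
  {D E : HTensor g h →L[ℂ] HTensor g h} {ρ : g →L[ℂ] g} {Γ Υ : HTensor g h →L[ℂ] k}
  {F V : g →L[ℂ] HTensor h k}

/-- The trace norm of `E^{1/2} (ρ ⊗ 1) D^{1/2}`. -/
def overlap (D E : HTensor g h →L[ℂ] HTensor g h) (ρ : g →L[ℂ] g) : ENNReal :=
  traceNorm (CFC.sqrt E ∘L tensorOp ρ 1 ∘L CFC.sqrt D)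

theorem overlap_eq (hD : 0 ≤ D) (hE : 0 ≤ E) (hΓ : Γ† ∘L Γ = D) (hΥ : Υ† ∘L Υ = E)
    (ρ : g →L[ℂ] g) : overlap D E ρ = traceNorm (Υ ∘L tensorOp ρ 1 ∘L Γ†) := by
  rw [overlap]
  conv_lhs => rw [← sqrt_adjoint D]
  exact traceNorm_comp_adjoint_congr _ ((sqrt_adjoint_comp_sqrt hD).trans hΓ.symm)
    ((sqrt_adjoint_comp_sqrt hE).trans hΥ.symm)

theorem overlap_comm (hρ : 0 ≤ ρ) : overlap D E ρ = overlap E D ρ := by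
  rw [overlap, ← traceNorm_adjoint, ContinuousLinearMap.adjoint_comp,
    ContinuousLinearMap.adjoint_comp, sqrt_adjoint, sqrt_adjoint, tensorOp_adjoint,
    adjoint_eq_self_of_nonneg hρ, ContinuousLinearMap.adjoint_one]
  rfl

theorem isTraceClass_comp_tensorOp (hD : IsOpDensity Jh Φ D) (hE : IsOpDensity Jh Ψ E)
    (hu : Φ 1 = 1) (hv : Ψ 1 = 1) (hΓ : Γ† ∘L Γ = D) (hΥ : Υ† ∘L Υ = E) (hρ : IsDensity ρ) :
    IsTraceClass (Υ ∘L tensorOp ρ 1 ∘L Γ†) := by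
  rw [← hρ.sqrt_comp_adjoint, comp_tensorOp_comp_adjoint]
  refine isTraceClass_comp (IsHS.adjoint ?_) ?_
  · rw [IsHS, hsNormSq_comp_tensorOp hD hu hΓ]; exact hρ.isHS_sqrt
  · rw [IsHS, hsNormSq_comp_tensorOp hE hv hΥ]; exact hρ.isHS_sqrt

theorem isTraceClass_sqrt_comp (hD : IsOpDensity Jh Φ D) (hE : IsOpDensity Jh Ψ E)
    (hu : Φ 1 = 1) (hv : Ψ 1 = 1) (hρ : IsDensity ρ) :
    IsTraceClass (CFC.sqrt E ∘L tensorOp ρ 1 ∘L CFC.sqrt D) := by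
  have h1 := isTraceClass_comp_tensorOp hD hE hu hv (sqrt_adjoint_comp_sqrt hD.1)
    (sqrt_adjoint_comp_sqrt hE.1) hρ
  rwa [sqrt_adjoint] at h1

theorem isTraceClass_stinespring (F V : g →L[ℂ] HTensor h k) (hρ : IsDensity ρ) :
    IsTraceClass (F ∘L ρ ∘L V†) :=
  hρ.traceClass.comp_comp F (V†)

theorem IsRealignment.isPartialTraceFst (hF : IsRealignment Jh F Γ) (hV : IsRealignment Jh V Υ)
    (hρ : IsDensity ρ) : IsPartialTraceFst (F ∘L ρ ∘L V†) (Γ ∘L tensorOp ρ 1 ∘L Υ†) := by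
  have h1 := isPartialTraceFst_of_realignment hF hV hρ.isHS_sqrt
  rwa [hρ.sqrt_comp_adjoint] at h1

theorem IsRealignment.opTrace_eq (hD : IsOpDensity Jh Φ D) (hE : IsOpDensity Jh Ψ E)
    (hu : Φ 1 = 1) (hv : Ψ 1 = 1) (hΓ : Γ† ∘L Γ = D) (hΥ : Υ† ∘L Υ = E)
    (hF : IsRealignment Jh F Γ) (hV : IsRealignment Jh V Υ) (hρ : IsDensity ρ) :
    opTrace (F ∘L ρ ∘L V†) = opTrace (Γ ∘L tensorOp ρ 1 ∘L Υ†) :=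
  ((hF.isPartialTraceFst hV hρ).hasSum (isTraceClass_stinespring F V hρ) (stdBasis k)).unique
    ((isTraceClass_comp_tensorOp hE hD hv hu hΥ hΓ hρ).hasSum (stdBasis k))

/-- The diagonal entry of `Υ (ρᵀ ⊗ 1) Γ†` at `b j` is `Tr(V_j ρᵀ F_j†)`, by the partial trace
formula; cyclicity turns it into the pairing. -/
theorem IsRealignment.hasSum_pairing (hD : IsOpDensity Jh Φ D) (hE : IsOpDensity Jh Ψ E)
    (hu : Φ 1 = 1) (hv : Ψ 1 = 1) (hΓ : Γ† ∘L Γ = D) (hΥ : Υ† ∘L Υ = E)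
    (hF : IsRealignment Jh F Γ) (hV : IsRealignment Jh V Υ) (b : HilbertBasis ι ℂ k)
    (hρ : IsDensity ρ) :
    HasSum (fun j => pairing Jg (((insertSnd (b j) : h →L[ℂ] HTensor h k)† ∘L F)† ∘L
      ((insertSnd (b j) : h →L[ℂ] HTensor h k)† ∘L V)) ρ)
      (opTrace (Υ ∘L tensorOp (transpose Jg ρ) 1 ∘L Γ†)) := by
  have hρ' := hρ.transpose Jg
  refine ((isTraceClass_comp_tensorOp hD hE hu hv hΓ hΥ hρ').hasSum b).congr_fun fun j => ?_
  rw [((hV.isPartialTraceFst hF hρ') (b j) (b j)).2, pairing]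
  set A : g →L[ℂ] h := (insertSnd (b j) : h →L[ℂ] HTensor h k)† ∘L F with hA
  have h1 : (insertSnd (b j) : h →L[ℂ] HTensor h k)† ∘L (V ∘L transpose Jg ρ ∘L F†) ∘L
      insertSnd (b j) = ((insertSnd (b j) : h →L[ℂ] HTensor h k)† ∘L V) ∘L transpose Jg ρ ∘L A† := by
    rw [hA, ContinuousLinearMap.adjoint_comp, ContinuousLinearMap.adjoint_adjoint]
    rfl
  rw [h1, hρ'.traceClass.opTrace_comp_comm]
  exact hρ'.traceClass.opTrace_comm _

end Overlap

/-! ### The suprema at a fixed density -/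

section Minimax

variable {g h : Type*}
  [NormedAddCommGroup g] [InnerProductSpace ℂ g] [CompleteSpace g]
  [NormedAddCommGroup h] [InnerProductSpace ℂ h] [CompleteSpace h]
  {ι : Type*} {Jg : Conjugation g} {Jh : Conjugation h} {Φ Ψ : (h →L[ℂ] h) →CP (g →L[ℂ] g)}
  {D E : HTensor g h →L[ℂ] HTensor g h} {ρ : g →L[ℂ] g}

theorem IsDensity.pairing_one (hρ : IsDensity ρ) : pairing Jg 1 ρ = 1 := by
  rw [pairing, one_mul, (hρ.transpose Jg).trace_eq_one]

/-- Transposition is an involution of the set of densities, so the `ρᵀ` in the trace pairing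
disappears in the infimum. -/
theorem iInf_isDensity_transpose (Jg : Conjugation g) (f : (g →L[ℂ] g) → EReal) :
    ⨅ (ρ : g →L[ℂ] g) (_ : IsDensity ρ), f (transpose Jg ρ) =
      ⨅ (ρ : g →L[ℂ] g) (_ : IsDensity ρ), f ρ := by
  refine le_antisymm (le_iInf₂ fun ρ hρ => ?_)
    (le_iInf₂ fun ρ hρ => iInf₂_le _ (hρ.transpose Jg))
  refine (iInf₂_le _ (hρ.transpose Jg)).trans_eq ?_
  rw [transpose_transpose]

theorem iSup_re_opTrace_eq_overlap (hD : IsOpDensity Jh Φ D) (hE : IsOpDensity Jh Ψ E)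
    (hu : Φ 1 = 1) (hv : Ψ 1 = 1) (hρ : IsDensity ρ) :
    ⨆ (Υ : HTensor g h →L[ℂ] HTensor g h) (_ : Υ† ∘L Υ = E),
      (((opTrace (Υ ∘L tensorOp ρ 1 ∘L CFC.sqrt D)).re : ℝ) : EReal) = overlap D E ρ := by
  have hs : (CFC.sqrt D)† ∘L CFC.sqrt D = D := sqrt_adjoint_comp_sqrt hD.1
  refine le_antisymm (iSup₂_le fun Υ hΥ => ?_) ?_
  · have h1 := isTraceClass_comp_tensorOp hD hE hu hv hs hΥ hρ
    rw [overlap_eq hD.1 hE.1 hs hΥ]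
    rw [sqrt_adjoint] at h1 ⊢
    exact (EReal.coe_le_coe_iff.2 (Complex.re_le_norm _)).trans (coe_norm_opTrace_le h1)
  · refine coe_traceNorm_le_of_forall_isometry (isTraceClass_sqrt_comp hD hE hu hv hρ) fun W hW => ?_
    exact le_iSup₂_of_le (W ∘L CFC.sqrt E) (isometry_comp_sqrt hE.1 hW) le_rfl

theorem iSup_stinespring_eq_overlap (hD : IsOpDensity Jh Φ D) (hE : IsOpDensity Jh Ψ E)
    (hu : Φ 1 = 1) (hv : Ψ 1 = 1) (hρ : IsDensity ρ) :
    ⨆ (F : g →L[ℂ] HTensor h (HTensor g h)) (_ : IsStinespring Φ F)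
      (V : g →L[ℂ] HTensor h (HTensor g h)) (_ : IsStinespring Ψ V),
        ((‖opTrace (F ∘L ρ ∘L V†)‖ : ℝ) : EReal) = overlap D E ρ := by
  rw [overlap_comm hρ.nonneg]
  refine le_antisymm (iSup₂_le fun F hF => iSup₂_le fun V hV => ?_) ?_
  · obtain ⟨Γ, hΓ, hF'⟩ := hF.exists_realignment hD
    obtain ⟨Υ, hΥ, hV'⟩ := hV.exists_realignment hE
    rw [IsRealignment.opTrace_eq hD hE hu hv hΓ hΥ hF' hV' hρ, overlap_eq hE.1 hD.1 hΥ hΓ]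
    exact coe_norm_opTrace_le (isTraceClass_comp_tensorOp hE hD hv hu hΥ hΓ hρ)
  · refine coe_traceNorm_le_of_forall_isometry (isTraceClass_sqrt_comp hE hD hv hu hρ) fun W hW => ?_
    -- One isometry suffices: `F` realigns `W Φ_τ^{1/2}` and `V` realigns the plain root of `Ψ_τ`.
    have hΓ := isometry_comp_sqrt hD.1 hW
    have hΥ := sqrt_adjoint_comp_sqrt hE.1
    obtain ⟨F, hF, hF'⟩ := exists_isStinespring hD hu hΓ
    obtain ⟨V, hV, hV'⟩ := exists_isStinespring hE hv hΥ
    refine le_iSup₂_of_le F hF (le_iSup₂_of_le V hV ?_)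
    rw [IsRealignment.opTrace_eq hD hE hu hv hΓ hΥ hF' hV' hρ, sqrt_adjoint]
    exact EReal.coe_le_coe_iff.2 (Complex.re_le_norm _)

theorem IsKraus.summable_pairing_and_le (hD : IsOpDensity Jh Φ D) (hE : IsOpDensity Jh Ψ E)
    (hu : Φ 1 = 1) (hv : Ψ 1 = 1) (b : HilbertBasis ι ℂ (HTensor g h)) (hρ : IsDensity ρ)
    {F V : ι → g →L[ℂ] h} (hF : IsKraus Φ F) (hV : IsKraus Ψ V) :
    Summable (fun j => pairing Jg ((F j)† ∘L V j) ρ) ∧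
      ((‖∑' j, pairing Jg ((F j)† ∘L V j) ρ‖ : ℝ) : EReal) ≤ overlap D E (transpose Jg ρ) := by
  obtain ⟨S, hS, hS'⟩ := hF.exists_isStinespring hu b
  obtain ⟨T, hT, hT'⟩ := hV.exists_isStinespring hv b
  obtain ⟨Γ, hΓ, hΓ'⟩ := hS.exists_realignment hD
  obtain ⟨Υ, hΥ, hΥ'⟩ := hT.exists_realignment hE
  have h1 := IsRealignment.hasSum_pairing (Jg := Jg) hD hE hu hv hΓ hΥ hΓ' hΥ' b hρ
  simp_rw [hS', hT'] at h1
  rw [h1.tsum_eq, overlap_eq hD.1 hE.1 hΓ hΥ]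
  exact ⟨h1.summable, coe_norm_opTrace_le
    (isTraceClass_comp_tensorOp hD hE hu hv hΓ hΥ (hρ.transpose Jg))⟩

theorem iSup_kraus_eq_overlap (hD : IsOpDensity Jh Φ D) (hE : IsOpDensity Jh Ψ E)
    (hu : Φ 1 = 1) (hv : Ψ 1 = 1) (b : HilbertBasis ι ℂ (HTensor g h)) (hρ : IsDensity ρ) :
    ⨆ (F : ι → g →L[ℂ] h) (_ : IsKraus Φ F) (V : ι → g →L[ℂ] h) (_ : IsKraus Ψ V),
      ((‖∑' j, pairing Jg ((F j)† ∘L V j) ρ‖ : ℝ) : EReal) = overlap D E (transpose Jg ρ) := by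
  refine le_antisymm (iSup₂_le fun F hF => iSup₂_le fun V hV =>
    (hF.summable_pairing_and_le hD hE hu hv b hρ hV).2) ?_
  have hρ' := hρ.transpose Jg
  refine coe_traceNorm_le_of_forall_isometry (isTraceClass_sqrt_comp hD hE hu hv hρ') fun W hW => ?_
  have hΓ := sqrt_adjoint_comp_sqrt hD.1
  -- Here `W` sits on the side of `Ψ`, because the Kraus sum of `F_j† V_j` is a trace with `Υ` on
  -- the left.
  have hΥ := isometry_comp_sqrt hE.1 hW
  obtain ⟨F, hF, hF'⟩ := exists_isStinespring hD hu hΓ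
  obtain ⟨V, hV, hV'⟩ := exists_isStinespring hE hv hΥ
  refine le_iSup₂_of_le _ (hF.isKraus b) (le_iSup₂_of_le _ (hV.isKraus b) ?_)
  rw [(IsRealignment.hasSum_pairing (Jg := Jg) hD hE hu hv hΓ hΥ hF' hV' b hρ).tsum_eq,
    sqrt_adjoint]
  exact EReal.coe_le_coe_iff.2 (Complex.re_le_norm _)

theorem IsStinespring.isPartialTraceFst {k : Type*} [NormedAddCommGroup k]
    [InnerProductSpace ℂ k] [CompleteSpace k] (hD : IsOpDensity Jh Φ D) (hE : IsOpDensity Jh Ψ E)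
    {F V : g →L[ℂ] HTensor h k} (hF : IsStinespring Φ F)
    (hV : IsStinespring Ψ V) (hρ : IsDensity ρ) :
    IsPartialTraceFst (F ∘L ρ ∘L V†) (partialTraceFst (F ∘L ρ ∘L V†)) ∧
      traceNorm (partialTraceFst (F ∘L ρ ∘L V†)) = overlap D E ρ := by
  obtain ⟨Γ, hΓ, hF'⟩ := hF.exists_realignment hD
  obtain ⟨Υ, hΥ, hV'⟩ := hV.exists_realignment hE
  have h1 := hF'.isPartialTraceFst hV' hρ
  rw [h1.partialTraceFst_eq, overlap_comm hρ.nonneg, overlap_eq hE.1 hD.1 hΥ hΓ]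
  exact ⟨h1, rfl⟩

theorem minimaxFidelity_eq_iInf_overlap (hD : IsOpDensity Jh Φ (opDensity Jh Φ))
    (hE : IsOpDensity Jh Ψ (opDensity Jh Ψ)) (hu : Φ 1 = 1) (hv : Ψ 1 = 1) :
    minimaxFidelity Jg Jh Φ Ψ = ⨅ (ρ : g →L[ℂ] g) (_ : IsDensity ρ),
      (overlap (opDensity Jh Φ) (opDensity Jh Ψ) ρ : EReal) := by
  refine iInf_congr fun ρ => iInf_congr fun hρ => ?_
  rw [← iSup_re_opTrace_eq_overlap hD hE hu hv hρ, hu, hv, hρ.pairing_one]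
  simp only [Complex.one_re, Real.sqrt_one, mul_one, div_one]

end Minimax

/-! ### Output states and their Uhlmann fidelity -/

section Predual

variable {g h k : Type*}
  [NormedAddCommGroup g] [InnerProductSpace ℂ g] [CompleteSpace g]
  [NormedAddCommGroup h] [InnerProductSpace ℂ h] [CompleteSpace h]
  [NormedAddCommGroup k] [InnerProductSpace ℂ k] [CompleteSpace k]
  {Jg : Conjugation g} {Jh : Conjugation h} {Φ Ψ : (h →L[ℂ] h) →CP (g →L[ℂ] g)}
  {D E : HTensor g h →L[ℂ] HTensor g h}

theorem IsPredual.unique {ρ : g →L[ℂ] g} {σ τ : h →L[ℂ] h} (hσ : IsPredual Jg Jh Φ ρ σ)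
    (hτ : IsPredual Jg Jh Φ ρ τ) : σ = τ := by
  have h1 : transpose Jh σ = transpose Jh τ := eq_of_opTrace_comp_eq fun B => by
    rw [← (hσ.1.transpose Jh).opTrace_comm, ← (hτ.1.transpose Jh).opTrace_comm]
    exact (hσ.2 B).symm.trans (hτ.2 B)
  rw [← transpose_transpose Jh σ, h1, transpose_transpose]

theorem IsPredual.predual_eq {ρ : g →L[ℂ] g} {σ : h →L[ℂ] h} (hσ : IsPredual Jg Jh Φ ρ σ) :
    predual Jg Jh Φ ρ = σ := by
  have h1 : ∃ σ, IsPredual Jg Jh Φ ρ σ := ⟨σ, hσ⟩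
  rw [predual, dif_pos h1]
  exact h1.choose_spec.unique hσ

theorem isPredual_predual (Jg : Conjugation g) (Jh : Conjugation h) (hΦ : IsChannel Φ)
    {ρ : g →L[ℂ] g} (hρ : IsTraceClass ρ) : IsPredual Jg Jh Φ ρ (predual Jg Jh Φ ρ) := by
  have h1 : ∃ σ, IsPredual Jg Jh Φ ρ σ := by
    obtain ⟨τ, hτ, hτ'⟩ := exists_isPredual_transpose hΦ (hρ.transpose Jg)
    refine ⟨transpose Jh τ, hτ.transpose Jh, fun B => ?_⟩
    rw [pairing, pairing, transpose_transpose]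
    exact hτ' B
  rw [predual, dif_pos h1]
  exact h1.choose_spec

/-- The predual of a rank-one operator is a block of the density; the conjugations cancel the
transpose in the pairing. -/
theorem IsOpDensity.isPredual_rankOne (hD : IsOpDensity Jh Φ D) (x y : g) :
    IsPredual Jg Jh Φ (InnerProductSpace.rankOne ℂ (Jg x) (Jg y))
      ((insertFst x : h →L[ℂ] HTensor g h)† ∘L D ∘L insertFst y) := by
  have hR := hD.isTraceClass x y
  refine ⟨hR, fun B => ?_⟩
  rw [pairing, transpose_rankOne, Jg.apply_apply, Jg.apply_apply]
  refine (opTrace_comp_rankOne _ _ _).trans ?_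
  rw [hD.opTrace_eq, hR.opTrace_comm, ← opTrace_transpose Jh (hR.comp_right _), transpose_comp,
    transpose_transpose]
  rfl

theorem IsPredualTensorId.unique {ω : HTensor g k →L[ℂ] HTensor g k}
    {θ θ' : HTensor h k →L[ℂ] HTensor h k} (hθ : IsPredualTensorId Jg Jh Φ ω θ)
    (hθ' : IsPredualTensorId Jg Jh Φ ω θ') : θ = θ' :=
  HTensor.clm_ext fun η' ζ' => HTensor.ext_inner fun η ζ => by
    have h1 := congrArg (fun T : h →L[ℂ] h => ⟪η, T η'⟫_ℂ)
      ((hθ.2 ζ ζ').trans (hθ'.2 ζ ζ').symm)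
    simp only [ContinuousLinearMap.comp_apply, ContinuousLinearMap.adjoint_inner_right] at h1
    exact h1

theorem IsPredualTensorId.predualTensorId_eq {ω : HTensor g k →L[ℂ] HTensor g k}
    {θ : HTensor h k →L[ℂ] HTensor h k} (hθ : IsPredualTensorId Jg Jh Φ ω θ) :
    predualTensorId Jg Jh Φ ω = θ := by
  have h1 : ∃ θ, IsPredualTensorId Jg Jh Φ ω θ := ⟨θ, hθ⟩
  rw [predualTensorId, dif_pos h1]
  exact h1.choose_spec.unique hθ

theorem insertSnd_add (ζ ζ' : k) :
    (insertSnd (ζ + ζ') : g →L[ℂ] HTensor g k) = insertSnd ζ + insertSnd ζ' := by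
  rw [insertSnd, map_add, ContinuousLinearMap.comp_add]; rfl

theorem insertSnd_smul (c : ℂ) (ζ : k) :
    (insertSnd (c • ζ) : g →L[ℂ] HTensor g k) = c • insertSnd ζ := by
  rw [insertSnd, map_smul, ContinuousLinearMap.comp_smul]; rfl

/-- The operator `ζ ↦ J (1 ⊗ ⟨ζ|) υ`. -/
def vectorOp (Jg : Conjugation g) (υ : HTensor g k) : k →L[ℂ] g :=
  LinearMap.mkContinuous
    { toFun := fun ζ => Jg (((insertSnd ζ : g →L[ℂ] HTensor g k)†) υ)
      map_add' := fun _ _ => by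
        rw [insertSnd_add, map_add, add_apply, Jg.map_add]
      map_smul' := fun _ _ => by
        rw [insertSnd_smul, map_smulₛₗ, smul_apply, Jg.map_smul, starRingEnd_self_apply,
          RingHom.id_apply] } ‖υ‖ fun ζ => by
    change ‖Jg (((insertSnd ζ : g →L[ℂ] HTensor g k)†) υ)‖ ≤ _
    rw [Jg.norm_apply, mul_comm]
    refine ContinuousLinearMap.le_of_opNorm_le _ ?_ _
    rw [LinearIsometryEquiv.norm_map]
    refine ContinuousLinearMap.opNorm_le_bound _ (norm_nonneg _) fun ξ => ?_
    rw [norm_insertSnd, mul_comm]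

theorem vectorOp_apply (υ : HTensor g k) (ζ : k) :
    vectorOp Jg υ ζ = Jg (((insertSnd ζ : g →L[ℂ] HTensor g k)†) υ) := rfl

theorem hsNormSq_vectorOp (υ : HTensor g k) : hsNormSq (vectorOp Jg υ) = ‖υ‖ₑ ^ 2 := by
  rw [hsNormSq, ← tsum_enorm_adjoint_insertSnd (stdBasis k)]
  refine tsum_congr fun i => ?_
  rw [vectorOp_apply, ← ofReal_norm, Jg.norm_apply, ofReal_norm]

/-- The vectors `J (N eᵢ)` are square-summable, hence are the slices of some `υ`. So every
Hilbert–Schmidt operator comes from a vector. -/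
theorem exists_vectorOp_eq (Jg : Conjugation g) {N : k →L[ℂ] g} (hN : IsHS N) :
    ∃ υ : HTensor g k, vectorOp Jg υ = N := by
  obtain ⟨υ, -, hυ⟩ := HTensor.hasSum_of_summable (stdBasis k)
    (y := fun i => Jg (N (stdBasis k i)))
    (by simpa only [Jg.norm_apply] using hN.summable_norm_sq (stdBasis k))
  refine ⟨υ, ContinuousLinearMap.ext_on (s := Set.range (stdBasis k))
    (Submodule.dense_iff_topologicalClosure_eq_top.2 (stdBasis k).dense_span) ?_⟩
  rintro _ ⟨i, rfl⟩
  rw [vectorOp_apply, hυ, Jg.apply_apply]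

theorem adjoint_insertSnd_comp_rankOne (υ : HTensor g k) (ζ ζ' : k) :
    (insertSnd ζ : g →L[ℂ] HTensor g k)† ∘L InnerProductSpace.rankOne ℂ υ υ ∘L insertSnd ζ' =
      InnerProductSpace.rankOne ℂ (Jg (vectorOp Jg υ ζ)) (Jg (vectorOp Jg υ ζ')) := by
  rw [vectorOp_apply, vectorOp_apply, Jg.apply_apply, Jg.apply_apply]
  ext x
  simp only [ContinuousLinearMap.comp_apply, InnerProductSpace.rankOne_apply, map_smul,
    ContinuousLinearMap.adjoint_inner_left]

/-- A square root of the output state `(Φ_⊺ ⊗ id)(|υ⟩⟨υ|)`. -/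
def outputFactor (D : HTensor g h →L[ℂ] HTensor g h) (N : k →L[ℂ] g) :
    HTensor h k →L[ℂ] HTensor g h :=
  (CFC.sqrt D ∘L tensorOp N (1 : h →L[ℂ] h)) ∘L tensorSwap k h

theorem outputFactor_comp_insertSnd (N : k →L[ℂ] g) (ζ : k) :
    outputFactor D N ∘L insertSnd ζ = CFC.sqrt D ∘L insertFst (N ζ) := by
  ext η
  simp only [outputFactor, ContinuousLinearMap.comp_apply, insertSnd_apply, tensorSwap_insertFst,
    tensorOp_insertFst]
  rfl

theorem outputFactor_comp_adjoint (N : k →L[ℂ] g) :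
    outputFactor E N ∘L (outputFactor D N)† =
      CFC.sqrt E ∘L tensorOp (N ∘L N†) 1 ∘L CFC.sqrt D := by
  conv_rhs => rw [← sqrt_adjoint D]
  rw [comp_tensorOp_comp_adjoint, outputFactor, outputFactor,
    ContinuousLinearMap.adjoint_comp _ (tensorSwap k h), adjoint_tensorSwap,
    ContinuousLinearMap.comp_assoc, ← ContinuousLinearMap.comp_assoc _ (tensorSwap h k),
    tensorSwap_comp_tensorSwap]
  rfl

theorem hsNormSq_outputFactor (hD : IsOpDensity Jh Φ D) (hu : Φ 1 = 1) (N : k →L[ℂ] g) :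
    hsNormSq (outputFactor D N) = hsNormSq N := by
  rw [← hsNormSq_comp_tensorOp hD hu (sqrt_adjoint_comp_sqrt hD.1), ← hsNormSq_adjoint,
    ← hsNormSq_adjoint (CFC.sqrt D ∘L _)]
  refine hsNormSq_adjoint_comp_eq ?_
  rw [ContinuousLinearMap.adjoint_adjoint, ContinuousLinearMap.adjoint_adjoint,
    outputFactor_comp_adjoint, ← comp_tensorOp_comp_adjoint, sqrt_adjoint]

/-- The slice of `X†X` at `ζ, ζ'` is the block of `D` at `N ζ, N ζ'`, which is the predual of the
slice of `|υ⟩⟨υ|`. -/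
theorem isPredualTensorId_outputFactor (hD : IsOpDensity Jh Φ D) (hu : Φ 1 = 1)
    (υ : HTensor g k) :
    IsPredualTensorId Jg Jh Φ (InnerProductSpace.rankOne ℂ υ υ)
      ((outputFactor D (vectorOp Jg υ))† ∘L outputFactor D (vectorOp Jg υ)) := by
  refine ⟨?_, fun ζ ζ' => ?_⟩
  · rw [IsTraceClass, traceNorm_adjoint_comp_self, hsNormSq_outputFactor hD hu, hsNormSq_vectorOp]
    finiteness
  · rw [adjoint_insertSnd_comp_rankOne (Jg := Jg), (hD.isPredual_rankOne _ _).predual_eq,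
      ← adjoint_comp_insertFst (sqrt_adjoint_comp_sqrt hD.1), ← outputFactor_comp_insertSnd,
      ← outputFactor_comp_insertSnd, ContinuousLinearMap.adjoint_comp]
    rfl

theorem isDensity_vectorOp {υ : HTensor g k} (hυ : ‖υ‖ = 1) :
    IsDensity (vectorOp Jg υ ∘L (vectorOp Jg υ)†) := by
  have h1 : hsNormSq ((vectorOp Jg υ)†) = 1 := by
    rw [hsNormSq_adjoint, hsNormSq_vectorOp, enorm_sq_eq_ofReal, hυ]; simp
  simpa using isDensity_adjoint_comp_self h1

theorem isDensity_outputFactor (hD : IsOpDensity Jh Φ D) (hu : Φ 1 = 1) {υ : HTensor g k}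
    (hυ : ‖υ‖ = 1) :
    IsDensity ((outputFactor D (vectorOp Jg υ))† ∘L outputFactor D (vectorOp Jg υ)) :=
  isDensity_adjoint_comp_self <| by
    rw [hsNormSq_outputFactor hD hu, hsNormSq_vectorOp, enorm_sq_eq_ofReal, hυ]; simp

/-- The fidelity is the trace norm of a product of square roots. Replacing these by the factors `X`
leaves `X_E X_D†`, in which the flips cancel. -/
theorem fidelity_outputFactor (hD : IsOpDensity Jh Φ D) (hE : IsOpDensity Jh Ψ E)
    (hu : Φ 1 = 1) (hv : Ψ 1 = 1) {υ : HTensor g k} (hυ : ‖υ‖ = 1) :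
    ((fidelity ((outputFactor D (vectorOp Jg υ))† ∘L outputFactor D (vectorOp Jg υ))
      ((outputFactor E (vectorOp Jg υ))† ∘L outputFactor E (vectorOp Jg υ)) : ℝ) : EReal) =
        overlap D E (vectorOp Jg υ ∘L (vectorOp Jg υ)†) := by
  have hθ := isDensity_outputFactor (Jg := Jg) hD hu hυ
  have hθ' := isDensity_outputFactor (Jg := Jg) hE hv hυ
  have hT := isTraceClass_comp hθ.isHS_sqrt hθ'.isHS_sqrt
  rw [fidelity_eq _ _ hθ'.nonneg hT, hT.coe_toReal_traceNorm, overlap,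
    ← outputFactor_comp_adjoint]
  have h1 := traceNorm_comp_adjoint_congr (.id ℂ _) (sqrt_adjoint_comp_sqrt hθ.nonneg)
    (sqrt_adjoint_comp_sqrt hθ'.nonneg)
  rw [sqrt_adjoint] at h1
  exact congrArg _ h1

theorem iInf_fidelity_eq (Jg : Conjugation g) (hD : IsOpDensity Jh Φ D) (hE : IsOpDensity Jh Ψ E)
    (hu : Φ 1 = 1) (hv : Ψ 1 = 1) :
    ⨅ (υ : HTensor g g) (_ : ‖υ‖ = 1),
        ((fidelity (predualTensorId Jg Jh Φ (InnerProductSpace.rankOne ℂ υ υ))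
          (predualTensorId Jg Jh Ψ (InnerProductSpace.rankOne ℂ υ υ)) : ℝ) : EReal) =
      ⨅ (ρ : g →L[ℂ] g) (_ : IsDensity ρ), (overlap D E ρ : EReal) := by
  have h1 : ∀ υ : HTensor g g, ‖υ‖ = 1 →
      ((fidelity (predualTensorId Jg Jh Φ (InnerProductSpace.rankOne ℂ υ υ))
          (predualTensorId Jg Jh Ψ (InnerProductSpace.rankOne ℂ υ υ)) : ℝ) : EReal) =
        overlap D E (vectorOp Jg υ ∘L (vectorOp Jg υ)†) := fun υ hυ => by
    rw [(isPredualTensorId_outputFactor hD hu υ).predualTensorId_eq,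
      (isPredualTensorId_outputFactor hE hv υ).predualTensorId_eq,
      fidelity_outputFactor hD hE hu hv hυ]
  refine le_antisymm (le_iInf₂ fun ρ hρ => ?_) (le_iInf₂ fun υ hυ => ?_)
  -- `υ` purifies `ρ`: its operator is `ρ^{1/2} : g → g`, so an ancilla equal to `g` is large
  -- enough.
  · obtain ⟨υ, hυ⟩ := exists_vectorOp_eq Jg hρ.isHS_sqrt
    have h2 : ‖υ‖ = 1 := by
      have h3 := hsNormSq_vectorOp (Jg := Jg) υ
      rw [hυ, hρ.hsNormSq_sqrt, enorm_sq_eq_ofReal, eq_comm, ENNReal.ofReal_eq_one] at h3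
      exact (pow_eq_one_iff_of_nonneg (norm_nonneg υ) two_ne_zero).1 h3
    refine (iInf₂_le υ h2).trans_eq ?_
    rw [h1 υ h2, hυ, hρ.sqrt_comp_adjoint]
  · rw [h1 υ hυ]
    exact iInf₂_le _ (isDensity_vectorOp hυ)

end Predual

end MinimaxFidelity

end

theorem mainTheorem2 {g h J : Type*}
    [NormedAddCommGroup g] [InnerProductSpace ℂ g] [CompleteSpace g]
    [TopologicalSpace.SeparableSpace g]
    [NormedAddCommGroup h] [InnerProductSpace ℂ h] [CompleteSpace h]
    [TopologicalSpace.SeparableSpace h]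
    (Jg : Conjugation g) (Jh : Conjugation h)
    (b : HilbertBasis J ℂ (HTensor g h))
    (Φ Ψ : (h →L[ℂ] h) →CP (g →L[ℂ] g))
    (hΦ : IsChannel Φ) (hΨ : IsChannel Ψ)
    (hΦτ : IsCompletelyMajorized Φ) (hΨτ : IsCompletelyMajorized Ψ) :
    -- the objects in the formulas are well defined
    (IsOpDensity Jh Φ (opDensity Jh Φ) ∧ IsOpDensity Jh Ψ (opDensity Jh Ψ)) ∧
    (∀ ρ : g →L[ℂ] g, IsDensity ρ →
      ∀ Γ Υ : HTensor g h →L[ℂ] HTensor g h,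
        Γ† ∘L Γ = opDensity Jh Φ → Υ† ∘L Υ = opDensity Jh Ψ →
          IsTraceClass (Υ ∘L tensorOp ρ 1 ∘L Γ†)) ∧
    (∀ ρ : g →L[ℂ] g, IsDensity ρ →
      ∀ F V : J → g →L[ℂ] h, IsKraus Φ F → IsKraus Ψ V →
        Summable (fun j => pairing Jg ((F j)† ∘L V j) ρ)) ∧
    (∀ ρ : g →L[ℂ] g, IsDensity ρ →
      ∀ F V : g →L[ℂ] HTensor h (HTensor g h), IsStinespring Φ F → IsStinespring Ψ V →
        IsTraceClass (F ∘L ρ ∘L V†) ∧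
        IsPartialTraceFst (F ∘L ρ ∘L V†) (partialTraceFst (F ∘L ρ ∘L V†))) ∧
    (∀ σ : g →L[ℂ] g, IsTraceClass σ →
      IsPredual Jg Jh Φ σ (predual Jg Jh Φ σ) ∧ IsPredual Jg Jh Ψ σ (predual Jg Jh Ψ σ)) ∧
    (∀ υ : HTensor g g, ‖υ‖ = 1 →
      let π := InnerProductSpace.rankOne ℂ υ υ
      IsPredualTensorId Jg Jh Φ π (predualTensorId Jg Jh Φ π) ∧
      IsPredualTensorId Jg Jh Ψ π (predualTensorId Jg Jh Ψ π) ∧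
      IsDensity (predualTensorId Jg Jh Φ π) ∧ IsDensity (predualTensorId Jg Jh Ψ π)) ∧
    -- the supremum over Kraus decompositions
    (minimaxFidelity Jg Jh Φ Ψ =
      ⨅ (ρ : g →L[ℂ] g) (_ : IsDensity ρ),
        ⨆ (F : J → g →L[ℂ] h) (_ : IsKraus Φ F) (V : J → g →L[ℂ] h) (_ : IsKraus Ψ V),
          ((‖∑' j, pairing Jg ((F j)† ∘L V j) ρ‖ : ℝ) : EReal)) ∧
    -- the Uhlmann fidelity of the output states
    (minimaxFidelity Jg Jh Φ Ψ =
      ⨅ (υ : HTensor g g) (_ : ‖υ‖ = 1),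
        ((fidelity (predualTensorId Jg Jh Φ (InnerProductSpace.rankOne ℂ υ υ))
          (predualTensorId Jg Jh Ψ (InnerProductSpace.rankOne ℂ υ υ)) : ℝ) : EReal)) ∧
    -- the supremum over Stinespring decompositions
    (minimaxFidelity Jg Jh Φ Ψ =
      ⨅ (ρ : g →L[ℂ] g) (_ : IsDensity ρ),
        ⨆ (F : g →L[ℂ] HTensor h (HTensor g h)) (_ : IsStinespring Φ F)
          (V : g →L[ℂ] HTensor h (HTensor g h)) (_ : IsStinespring Ψ V),
          ((‖opTrace (F ∘L ρ ∘L V†)‖ : ℝ) : EReal)) ∧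
    -- the trace norm formula, for every choice of the Stinespring operators
    (∀ F V : g →L[ℂ] HTensor h (HTensor g h), IsStinespring Φ F → IsStinespring Ψ V →
      minimaxFidelity Jg Jh Φ Ψ =
        ⨅ (ρ : g →L[ℂ] g) (_ : IsDensity ρ),
          (traceNorm (partialTraceFst (F ∘L ρ ∘L V†)) : EReal)) := by
  have hu := hΦ.unital
  have hv := hΨ.unital
  have hD := isOpDensity_opDensity Jh hΦ hΦτ
  have hE := isOpDensity_opDensity Jh hΨ hΨτ
  have hf := minimaxFidelity_eq_iInf_overlap (Jg := Jg) hD hE hu hv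
  refine ⟨⟨hD, hE⟩, fun ρ hρ Γ Υ hΓ hΥ => isTraceClass_comp_tensorOp hD hE hu hv hΓ hΥ hρ,
    fun ρ hρ F V hF hV => (hF.summable_pairing_and_le hD hE hu hv b hρ hV).1,
    fun ρ hρ F V hF hV => ⟨isTraceClass_stinespring F V hρ,
      (hF.isPartialTraceFst hD hE hV hρ).1⟩,
    fun σ hσ => ⟨isPredual_predual Jg Jh hΦ hσ, isPredual_predual Jg Jh hΨ hσ⟩,
    fun υ hυ => ?_, ?_, ?_, ?_, fun F V hF hV => ?_⟩
  · have h1 := isPredualTensorId_outputFactor (Jg := Jg) hD hu υ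
    have h2 := isPredualTensorId_outputFactor (Jg := Jg) hE hv υ
    intro π
    rw [h1.predualTensorId_eq, h2.predualTensorId_eq]
    exact ⟨h1, h2, isDensity_outputFactor hD hu hυ, isDensity_outputFactor hE hv hυ⟩
  · rw [hf, ← iInf_isDensity_transpose Jg]
    exact iInf_congr fun ρ => iInf_congr fun hρ =>
      (iSup_kraus_eq_overlap hD hE hu hv b hρ).symm
  · rw [hf, iInf_fidelity_eq Jg hD hE hu hv]
  · rw [hf]
    exact iInf_congr fun ρ => iInf_congr fun hρ =>
      (iSup_stinespring_eq_overlap hD hE hu hv hρ).symm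
  · rw [hf]
    exact iInf_congr fun ρ => iInf_congr fun hρ => by
      rw [(hF.isPartialTraceFst hD hE hV hρ).2]
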